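/- For a prime $p$ let $p^{+}$ be the least prime greater than $p$, let $p^{+(j)}$ be the $j$-th successor prime ($p^{+(0)}=p$), and let $g(p)=p^{+}-p$. For an integer $t\ge 1$ put $$\mathbf G^{(t)}(p)=\bigl(g(p),g(p^{+}),\dots,g(p^{+(t-1)})\bigr),$$ and for real $X$ let $\mu_X^{(t)}$ be the law of $\mathbf G^{(t)}(P)$, where $P$ is uniformly distributed on the primes in $[X,2X]$. For $\mathbf g=(g_1,\dots,g_t)$, a vector of nonnegative integers, put $H_0=0$ and $H_k=g_1+\cdots+g_k$, and let $$\mathfrak S(0,H_1,\dots,H_t)=\prod_{q\ \mathrm{prime}}\Bigl(1-\frac{\nu(q)}{q}\Bigr)\Bigl(1-\frac1q\Bigr)^{-|\mathcal H|}$$ be the Hardy–Littlewood singular series of the set $\mathcal H=\{0,H_1,\dots,H_t\}$, where $\nu(q)$ is the number of residue classes modulo $q$ occupied by $\mathcal H$. Logarithms are natural. Theorem. Fix an integer $t\ge1$. There are a constant $C_t>0$, a real number $X_0=X_0(t)$ and a nonnegative integer $A=A_t$, all depending only on $t$, such that the following hold. (i) For all real $X\ge X_0$ and all $\mathbf g\in\mathbb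 Z_{\ge0}^t$, $$\mu_X^{(t)}(\mathbf g)\le C_t\,\frac{\mathfrak S(0,H_1,\dots,H_t)}{(\log X)^t}.$$ (ii) For every real $K>0$ there is a constant $D_{t,K}>0$ such that for all real $X\ge X_0$ and all $\mathbf g\in\mathbb Z_{\ge0}^t$ with $H_t\le KX$, $$C_t\,\frac{\mathfrak S(0,H_1,\dots,H_t)}{(\log X)^t}\le D_{t,K}\,\frac{(\log\log(3X))^{A}}{(\log X)^t}.$$ (iii) There is a constant $D_t>0$ such that for all real $X\ge X_0$ and all $\mathbf g\in\mathbb Z_{\ge0}^t$ (with no restriction on $H_t$), $$\mu_X^{(t)}(\mathbf g)\le D_t\,\frac{(\log\log(3X))^{A}}{(\log X)^t}.$$ -/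

import Mathlib

noncomputable section

namespace PrimeGaps

/-- The next prime `p⁺`: the least prime strictly greater than `p`. -/
def nextPrime (p : ℕ) : ℕ := Nat.find (Nat.exists_infinite_primes (p + 1))

/-- The consecutive gap vector `(g(p), g(p⁺), …, g(p^{+(t-1)}))`, where `g(q) = q⁺ - q` and
`p^{+(j)}` is the `j`-th successor prime of `p`. -/
def gapVector (t : ℕ) (p : ℕ) : Fin t → ℕ :=
  fun i => nextPrime (nextPrime^[(i : ℕ)] p) - nextPrime^[(i : ℕ)] p

/-- The set of primes in the dyadic interval `[X, 2X]`. -/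
def dyadicPrimes (X : ℝ) : Set ℕ := {p | p.Prime ∧ X ≤ (p : ℝ) ∧ (p : ℝ) ≤ 2 * X}

/-- The law of `gapVector t P` for `P` uniform among the primes in `[X, 2X]`. -/
def gapLaw (t : ℕ) (X : ℝ) : MeasureTheory.Measure (Fin t → ℕ) :=
  (ProbabilityTheory.uniformOn (dyadicPrimes X)).map (gapVector t)

/-- The cumulative offset `H_k = g_1 + ⋯ + g_k` for `0 ≤ k ≤ t` (so `H_0 = 0`). -/
def offset {t : ℕ} (g : Fin t → ℕ) (k : Fin (t + 1)) : ℕ :=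
  ∑ i : Fin t with i.val < k.val, g i

/-- The set of offsets `{H_0, H_1, …, H_t}`. -/
def offsetSet {t : ℕ} (g : Fin t → ℕ) : Finset ℕ := Finset.univ.image (offset g)

/-- The number of residue classes modulo `p` occupied by `H`. -/
def residueCount (H : Finset ℕ) (p : ℕ) : ℕ := (H.image (fun h => h % p)).card

/-- The local factor at `p` of the singular series of `H`. -/
def singularFactor (H : Finset ℕ) (p : ℕ) : ℝ :=
  (1 - (residueCount H p : ℝ) / p) * ((1 - 1 / (p : ℝ)) ^ H.card)⁻¹

/-- The Hardy–Littlewood singular series of a finite set `H`: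
`∏_p (1 - ν_H(p)/p) (1 - 1/p)^{-|H|}`; the product converges by `multipliable_singularFactor`. -/
def singularSeries (H : Finset ℕ) : ℝ := ∏' p : Nat.Primes, singularFactor H p

theorem one_sub_pow_le (k : ℕ) (x : ℝ) (h0 : 0 ≤ x) (h1 : x ≤ 1) :
    (1 - x) ^ k ≤ 1 - k * x + (k : ℝ) ^ 2 * x ^ 2 := by
  induction k with
  | zero => simp
  | succ n ih =>
    have h := mul_le_mul_of_nonneg_right ih (sub_nonneg.2 h1)
    rw [pow_succ]
    push_cast
    have hn : (0 : ℝ) ≤ n := Nat.cast_nonneg n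
    have h3 : 0 ≤ (n : ℝ) ^ 2 * x ^ 3 := by positivity
    nlinarith [mul_nonneg hn (sq_nonneg x), sq_nonneg x]

theorem abs_singularFactor_sub_one_le (H : Finset ℕ) (p : ℕ) (hp : 2 ≤ p)
    (hH : ∀ h ∈ H, h < p) :
    |singularFactor H p - 1| ≤ (2 : ℝ) ^ H.card * (H.card : ℝ) ^ 2 * (1 / (p : ℝ) ^ 2) := by
  have hcard : residueCount H p = H.card := by
    unfold residueCount
    apply Finset.card_image_of_injOn
    intro a ha b hb hab
    simpa [Nat.mod_eq_of_lt (hH a ha), Nat.mod_eq_of_lt (hH b hb)] using hab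
  unfold singularFactor
  rw [hcard]
  set k := H.card
  have hp' : (2 : ℝ) ≤ p := by exact_mod_cast hp
  have hx2 : 1 / (p : ℝ) ≤ 1 / 2 := one_div_le_one_div_of_le (by norm_num) hp'
  have hx0 : 0 ≤ 1 / (p : ℝ) := by positivity
  have e1 : (k : ℝ) / p = k * (1 / (p : ℝ)) := by ring
  have e2 : 1 / (p : ℝ) ^ 2 = (1 / (p : ℝ)) ^ 2 := by simp
  rw [e1, e2]
  generalize 1 / (p : ℝ) = x at hx2 hx0
  have hpos : 0 < (1 - x) ^ k := pow_pos (by linarith) k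
  have hlow : 1 - k * x ≤ (1 - x) ^ k := by
    have := one_add_mul_le_pow (a := -x) (by linarith) k
    calc 1 - k * x = 1 + k * (-x) := by ring
      _ ≤ (1 + -x) ^ k := this
      _ = (1 - x) ^ k := by ring
  have hup := one_sub_pow_le k x hx0 (by linarith)
  have hinv : ((1 - x) ^ k)⁻¹ ≤ 2 ^ k := by
    rw [← inv_pow]
    apply pow_le_pow_left₀ (inv_nonneg.2 (by linarith))
    rw [inv_le_comm₀ (by linarith) (by norm_num)]
    linarith
  have e3 : (1 - k * x) * ((1 - x) ^ k)⁻¹ - 1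
      = -(((1 - x) ^ k - (1 - k * x)) * ((1 - x) ^ k)⁻¹) := by
    field_simp
    ring
  rw [e3, abs_neg, abs_of_nonneg (mul_nonneg (by linarith) (inv_nonneg.2 hpos.le))]
  calc ((1 - x) ^ k - (1 - k * x)) * ((1 - x) ^ k)⁻¹
      ≤ ((k : ℝ) ^ 2 * x ^ 2) * 2 ^ k :=
        mul_le_mul (by linarith) hinv (inv_nonneg.2 hpos.le) (by positivity)
    _ = 2 ^ k * (k : ℝ) ^ 2 * x ^ 2 := by ring

/-- The Euler product defining the singular series converges. -/
theorem multipliable_singularFactor (H : Finset ℕ) :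
    Multipliable (fun p : Nat.Primes => singularFactor H p) := by
  have hs : Summable (fun p : Nat.Primes => singularFactor H p - 1) := by
    have hb : Summable (fun p : Nat.Primes =>
        (2 : ℝ) ^ H.card * (H.card : ℝ) ^ 2 * (1 / ((p : ℕ) : ℝ) ^ 2)) :=
      ((Real.summable_one_div_nat_pow.2 one_lt_two).comp_injective
        Subtype.val_injective).mul_left _
    refine hb.of_norm_bounded_eventually ?_
    have hfin : {p : Nat.Primes | (p : ℕ) ≤ H.sup id}.Finite :=
      Set.Finite.preimage Subtype.val_injective.injOn (Set.finite_Iic (H.sup id))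
    refine hfin.subset ?_
    intro p hp
    by_contra hlt
    apply hp
    change ‖singularFactor H p.1 - 1‖ ≤ _
    refine (Real.norm_eq_abs _).trans_le ?_
    refine abs_singularFactor_sub_one_le H p p.2.two_le fun h hh => ?_
    have hle : h ≤ H.sup id := Finset.le_sup (f := id) hh
    have hlt' : ¬ (p.1 ≤ H.sup id) := hlt
    omega
  have := Real.multipliable_one_add_of_summable hs
  simpa using this

end PrimeGaps

end

/-! ### Mertens-type estimates -/

namespace PrimeGaps

open Finset

/-! If the gap vector at a prime `p` is `g`, then every `p + h` with `h` in `H = offsetSet g` is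
prime. So the number of such `p` in `[X, 2X]` is at most the number of `n` there for which all `n +
h` are prime. An upper bound sieve makes this `O(X 𝔖(H) / (log X)^(t+1))`
(`exists_card_prime_tuples_le`), and dividing by the Chebyshev bound of order `X / log X` for the
number of primes gives (i).

The point is uniformity in `H`. Selberg's sieve with level a small power of `X` has remainders
bounded by `|r_d| ≤ d` whatever `H` is (`abs_card_filter_dvd_sub_le`). Its main term is controlled
by `∏_{p ≤ z} (1 - ν(p)/p)`, once Rankin's trick (`half_prod_inv_le_selbergSum`) shows that
truncating Selberg's sum at the level costs at most a factor 2. This product is the truncated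
singular series times `∏_{p ≤ z} (1 - 1/p)^(t+1)`, and the tail of the singular series is at least
1/2 beyond a point depending on `#H` only (`half_prod_singularFactor_le`).

For (ii), a local factor exceeds 1 only at primes dividing the product of the differences of `H`.
That product is at most a power of `3X`, so the product of `(1 - 1/p)⁻¹` over its prime factors is
at most a power of `log log (3X)`. For (iii), either `g` does not occur and the mass is 0, or
Bertrand's postulate forces `H_t ≤ 2^(t+1) X` and (i), (ii) apply. -/

theorem pow_div_dvd_factorial (n : ℕ) {p : ℕ} (hp : p.Prime) : p ^ (n / p) ∣ n.factorial := by
  refine dvd_trans ?_ (Nat.factorial_dvd_factorial (Nat.mul_div_le n p))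
  rw [hp.pow_dvd_iff_le_factorization (Nat.factorial_ne_zero _),
    Nat.factorization_factorial_mul hp]
  omega

/-- The pairwise coprime powers `p ^ (n / p)` all divide `n!`, which is at most `n ^ n`; take
logarithms of their product. -/
theorem sum_div_mul_log_primesLE_le (n : ℕ) :
    ∑ p ∈ n.primesLE, ((n / p : ℕ) : ℝ) * Real.log p ≤ n * Real.log n := by
  have hdvd : ∏ p ∈ n.primesLE, p ^ (n / p) ∣ n.factorial := by
    refine Finset.prod_dvd_of_isRelPrime ?_ fun p hp =>
      pow_div_dvd_factorial n (Nat.prime_of_mem_primesLE hp)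
    intro p hp q hq hpq
    exact (Nat.coprime_iff_isRelPrime.1 (Nat.Coprime.pow _ _ ((Nat.coprime_primes
      (Nat.prime_of_mem_primesLE hp) (Nat.prime_of_mem_primesLE hq)).2 hpq)))
  have hle : ∏ p ∈ n.primesLE, p ^ (n / p) ≤ n ^ n :=
    (Nat.le_of_dvd (Nat.factorial_pos n) hdvd).trans (Nat.factorial_le_pow n)
  have hpos : ∀ p ∈ n.primesLE, (0 : ℝ) < p := fun p hp => by
    exact_mod_cast (Nat.prime_of_mem_primesLE hp).pos
  have hle' : (∏ p ∈ n.primesLE, (p : ℝ) ^ (n / p)) ≤ (n : ℝ) ^ n := by exact_mod_cast hle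
  have := Real.log_le_log (Finset.prod_pos fun p hp => pow_pos (hpos p hp) _) hle'
  rw [Real.log_prod (fun p hp => (pow_pos (hpos p hp) _).ne'), Real.log_pow] at this
  simpa only [Real.log_pow] using this

/-- The upper half of Mertens' first theorem. -/
theorem sum_log_div_primesLE_le (n : ℕ) :
    ∑ p ∈ n.primesLE, Real.log p / p ≤ Real.log n + Real.log 4 := by
  rcases n.eq_zero_or_pos with rfl | hn
  · simp [Real.log_nonneg]
  have hn' : (0 : ℝ) < n := by exact_mod_cast hn
  have h1 := sum_div_mul_log_primesLE_le n
  have h2 : ∑ p ∈ n.primesLE, Real.log p ≤ Real.log 4 * n := by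
    rw [← Chebyshev.theta_eq_sum_primesLE_log]
    exact Chebyshev.theta_le_log4_mul_x hn'.le
  have h3 : ∑ p ∈ n.primesLE, (n : ℝ) * (Real.log p / p) ≤
      ∑ p ∈ n.primesLE, (((n / p : ℕ) : ℝ) * Real.log p + Real.log p) := by
    refine Finset.sum_le_sum fun p hp => ?_
    have hp0 : (0 : ℝ) < p := by exact_mod_cast (Nat.prime_of_mem_primesLE hp).pos
    have hl : 0 ≤ Real.log p := Real.log_natCast_nonneg p
    have : (n : ℝ) / p ≤ ((n / p : ℕ) : ℝ) + 1 := by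
      rw [← Nat.floor_div_eq_div (K := ℝ)]
      exact (Nat.lt_floor_add_one _).le
    calc (n : ℝ) * (Real.log p / p) = (n / p) * Real.log p := by ring
      _ ≤ (((n / p : ℕ) : ℝ) + 1) * Real.log p := by gcongr
      _ = _ := by ring
  rw [← Finset.mul_sum, Finset.sum_add_distrib] at h3
  have h4 : (n : ℝ) * ∑ p ∈ n.primesLE, Real.log p / p ≤ n * (Real.log n + Real.log 4) := by
    linarith
  exact le_of_mul_le_mul_left h4 hn'

/-- Expanding the Euler product gives the sum of `1/m` over all `m` with prime factors at most `n`.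
This contains the harmonic sum up to `n`, which is at least `log n`. -/
theorem log_le_prod_one_sub_inv (n : ℕ) :
    Real.log n ≤ ∏ p ∈ n.primesLE, (1 - 1 / (p : ℝ))⁻¹ := by
  rcases n.eq_zero_or_pos with rfl | hn
  · simp
  let f : ℕ →* ℝ :=
    { toFun := fun m => (m : ℝ)⁻¹, map_one' := by simp, map_mul' := fun a b => by
        push_cast; exact mul_inv _ _ }
  have hf : ∀ m, f m = (m : ℝ)⁻¹ := fun _ => rfl
  have hlt : ∀ {p : ℕ}, p.Prime → ‖f p‖ < 1 := by
    intro p hp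
    have : (1 : ℝ) < p := by exact_mod_cast hp.one_lt
    rw [hf, Real.norm_of_nonneg (by positivity)]
    exact inv_lt_one_of_one_lt₀ this
  have h := (EulerProduct.summable_and_hasSum_smoothNumbers_prod_primesBelow_geometric hlt
    (n + 1)).2
  have hS : ∑ m ∈ Finset.Icc 1 n, (m : ℝ)⁻¹ ≤ ∏ p ∈ (n + 1).primesBelow, (1 - f p)⁻¹ := by
    rw [← Finset.sum_attach]
    have hmem : ∀ m : Finset.Icc 1 n, (m : ℕ) ∈ (n + 1).smoothNumbers := fun m => by
      obtain ⟨h1, h2⟩ := Finset.mem_Icc.1 m.2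
      exact Nat.mem_smoothNumbers_of_lt h1 (Nat.lt_succ_of_le h2)
    let e : Finset.Icc 1 n ↪ (n + 1).smoothNumbers :=
      ⟨fun m => ⟨m, hmem m⟩, fun a b hab => Subtype.ext (by simpa using hab)⟩
    have := sum_le_hasSum ((Finset.Icc 1 n).attach.map e)
      (fun i _ => (by rw [hf]; positivity : 0 ≤ f i)) h
    rw [Finset.sum_map] at this
    exact this
  have hlog := log_le_harmonic_floor (n : ℝ) (Nat.cast_nonneg n)
  rw [Nat.floor_natCast, harmonic_eq_sum_Icc] at hlog
  push_cast at hlog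
  calc Real.log n ≤ _ := hlog
    _ ≤ _ := hS
    _ = _ := by simp only [hf, one_div, Nat.primesLE]

theorem prod_one_sub_inv_primesLE_le {n : ℕ} (hn : 2 ≤ n) :
    ∏ p ∈ n.primesLE, (1 - 1 / (p : ℝ)) ≤ (Real.log n)⁻¹ := by
  have h := log_le_prod_one_sub_inv n
  rw [Finset.prod_inv_distrib] at h
  have hl : 0 < Real.log n := Real.log_pos (by exact_mod_cast hn)
  exact (le_inv_comm₀ hl (inv_pos.1 (hl.trans_le h))).1 h

/-- Each squaring of the range adds at most 4: for `a < p ≤ a²` one has `1/p ≤ (log p / p) / log a`,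
and Mertens' first theorem bounds the sum by `(2 log a + log 4) / log a`. -/
theorem sum_inv_primesLE_two_pow_two_pow_le (n : ℕ) :
    ∑ p ∈ Nat.primesLE (2 ^ 2 ^ n), 1 / (p : ℝ) ≤ 4 * n + 1 := by
  induction n with
  | zero =>
    have : Nat.primesLE (2 ^ 2 ^ 0) = {2} := by decide
    rw [this]; norm_num
  | succ n ih =>
    set a := 2 ^ 2 ^ n with ha
    set b := 2 ^ 2 ^ (n + 1) with hb
    have hab : a ≤ b := Nat.pow_le_pow_right two_pos (Nat.pow_le_pow_right two_pos n.le_succ)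
    rw [← Finset.sum_sdiff (Nat.primesLE_mono hab)]
    have hla : Real.log a = 2 ^ n * Real.log 2 := by rw [ha]; push_cast; rw [Real.log_pow]; norm_cast
    have hlb : Real.log b = 2 * 2 ^ n * Real.log 2 := by
      rw [hb]; push_cast; rw [Real.log_pow]; push_cast; ring
    have hl2 : 0 < Real.log 2 := Real.log_pos one_lt_two
    have hla0 : 0 < Real.log a := by rw [hla]; positivity
    have hl4 : Real.log 4 = 2 * Real.log 2 := by
      rw [show (4 : ℝ) = 2 ^ 2 by norm_num, Real.log_pow]; norm_num
    have hD : ∑ p ∈ b.primesLE \ a.primesLE, 1 / (p : ℝ) ≤ 4 := by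
      have h1 : ∑ p ∈ b.primesLE \ a.primesLE, 1 / (p : ℝ) ≤
          ∑ p ∈ b.primesLE \ a.primesLE, (Real.log a)⁻¹ * (Real.log p / p) := by
        refine Finset.sum_le_sum fun p hp => ?_
        obtain ⟨h1, h2⟩ := Finset.mem_sdiff.1 hp
        have hpp := Nat.prime_of_mem_primesLE h1
        have hap : a < p := by
          by_contra hle
          exact h2 (Nat.mem_primesLE.2 ⟨not_lt.1 hle, hpp⟩)
        have hp0 : (0 : ℝ) < p := by exact_mod_cast hpp.pos
        have hlog : Real.log a ≤ Real.log p :=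
          Real.log_le_log (by rw [ha]; positivity) (by exact_mod_cast hap.le)
        have : 1 ≤ (Real.log a)⁻¹ * Real.log p := by
          rw [inv_mul_eq_div, one_le_div hla0]; exact hlog
        calc 1 / (p : ℝ) ≤ ((Real.log a)⁻¹ * Real.log p) / p := by gcongr
          _ = _ := by ring
      have h2 : ∑ p ∈ b.primesLE \ a.primesLE, Real.log p / p ≤
          ∑ p ∈ b.primesLE, Real.log p / p :=
        Finset.sum_le_sum_of_subset_of_nonneg Finset.sdiff_subset fun p _ _ =>
          div_nonneg (Real.log_natCast_nonneg p) (Nat.cast_nonneg p)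
      have h3 := sum_log_div_primesLE_le b
      rw [← Finset.mul_sum] at h1
      refine h1.trans ?_
      rw [inv_mul_le_iff₀ hla0]
      have h4 : (1 : ℝ) ≤ 2 ^ n := one_le_pow₀ one_le_two
      rw [hlb, hl4] at h3
      rw [hla]
      nlinarith
    push_cast
    linarith

/-- A weak form of Mertens' third theorem. -/
theorem exists_prod_inv_one_sub_inv_le :
    ∃ C : ℝ, 0 < C ∧ ∀ n : ℕ, 2 ≤ n →
      ∏ p ∈ n.primesLE, (1 - 1 / (p : ℝ))⁻¹ ≤ C * Real.log n ^ 16 := by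
  have hl2 : 0 < Real.log 2 := Real.log_pos one_lt_two
  refine ⟨Real.exp 2 * 2 ^ 16 * (2 / Real.log 2) ^ 16, by positivity, fun n hn => ?_⟩
  set m := Nat.clog 2 (Nat.clog 2 n) with hm
  have hnm : n ≤ 2 ^ 2 ^ m :=
    (Nat.le_pow_clog one_lt_two n).trans
      (Nat.pow_le_pow_right two_pos (Nat.le_pow_clog one_lt_two _))
  have hterm : ∀ p ∈ n.primesLE, (1 - 1 / (p : ℝ))⁻¹ ≤ Real.exp (2 * (1 / (p : ℝ))) := by
    intro p hp
    have hp2 : (2 : ℝ) ≤ p := by exact_mod_cast Nat.two_le_of_mem_primesLE hp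
    have hx : 1 / (p : ℝ) ≤ 1 / 2 := one_div_le_one_div_of_le two_pos hp2
    have hx0 : 0 ≤ 1 / (p : ℝ) := by positivity
    generalize 1 / (p : ℝ) = x at hx hx0
    refine le_trans ?_ (Real.add_one_le_exp _)
    rw [inv_le_iff_one_le_mul₀ (by linarith)]
    nlinarith
  have h1 : ∏ p ∈ n.primesLE, (1 - 1 / (p : ℝ))⁻¹ ≤
      Real.exp (2 * ∑ p ∈ n.primesLE, 1 / (p : ℝ)) := by
    rw [Finset.mul_sum, Real.exp_sum]
    refine Finset.prod_le_prod (fun p hp => ?_) hterm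
    have hp2 : (1 : ℝ) ≤ p := by exact_mod_cast (Nat.one_lt_of_mem_primesLE hp).le
    exact inv_nonneg.2 (sub_nonneg.2 ((div_le_one (by linarith)).2 hp2))
  have h2 : ∑ p ∈ n.primesLE, 1 / (p : ℝ) ≤ 4 * m + 1 :=
    (Finset.sum_le_sum_of_subset_of_nonneg (Nat.primesLE_mono hnm)
      fun p _ _ => by positivity).trans (sum_inv_primesLE_two_pow_two_pow_le m)
  have hln : 0 < Real.log n := Real.log_pos (by exact_mod_cast hn)
  have hclog : (2 : ℝ) ^ m ≤ 4 * (Real.log n / Real.log 2) := by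
    have e1 : (Nat.clog 2 n : ℝ) ≤ 2 * (Real.log n / Real.log 2) := by
      have hc : 1 ≤ Nat.clog 2 n := Nat.clog_pos one_lt_two hn
      have := Nat.pow_pred_clog_lt_self one_lt_two (by omega : 1 < n)
      have h' : ((2 : ℝ) ^ (Nat.clog 2 n).pred) ≤ n := by exact_mod_cast this.le
      have h'' := Real.log_le_log (by positivity) h'
      rw [Real.log_pow, ← le_div_iff₀ hl2] at h''
      have h3 : 1 ≤ Real.log n / Real.log 2 := by
        rw [one_le_div hl2]
        exact Real.log_le_log two_pos (by exact_mod_cast hn)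
      have h4 : ((Nat.clog 2 n).pred : ℝ) = Nat.clog 2 n - 1 := by
        rw [Nat.pred_eq_sub_one, Nat.cast_sub hc, Nat.cast_one]
      linarith
    have e2 : (2 : ℝ) ^ m ≤ 2 * (Nat.clog 2 n : ℝ) := by
      rcases Nat.lt_or_ge 1 (Nat.clog 2 n) with h | h
      · have := Nat.pow_pred_clog_lt_self one_lt_two h
        have hc : 1 ≤ m := Nat.clog_pos one_lt_two h
        have h5 : 2 ^ m = 2 * 2 ^ m.pred := by
          rw [← pow_succ']; congr 1; exact (Nat.succ_pred_eq_of_pos hc).symm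
        exact_mod_cast (h5.le.trans (Nat.mul_le_mul_left 2 this.le))
      · have hc : 1 ≤ Nat.clog 2 n := Nat.clog_pos one_lt_two hn
        have : Nat.clog 2 n = 1 := le_antisymm h hc
        rw [hm, this]; norm_num
    linarith
  -- Source of the exponent 16: `e ≤ 4` turns `exp (8m)` into `(2 ^ m) ^ 16`, and `2 ^ m` is of
  -- order `log n`.
  have hexp : Real.exp 1 ≤ 2 ^ 2 := by
    have := Real.exp_one_lt_d9; norm_num at this ⊢; linarith
  calc _ ≤ Real.exp (2 * ∑ p ∈ n.primesLE, 1 / (p : ℝ)) := h1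
    _ ≤ Real.exp (2 + (8 * m : ℕ) * 1) := by
        apply Real.exp_le_exp.2; push_cast; linarith
    _ = Real.exp 2 * Real.exp 1 ^ (8 * m) := by rw [Real.exp_add, Real.exp_nat_mul]
    _ ≤ Real.exp 2 * (2 ^ 2) ^ (8 * m) := by gcongr
    _ = Real.exp 2 * (2 ^ m) ^ 16 := by rw [← pow_mul, ← pow_mul]; congr 2; ring
    _ ≤ Real.exp 2 * (4 * (Real.log n / Real.log 2)) ^ 16 := by gcongr
    _ = (Real.exp 2 * 2 ^ 16) * ((2 / Real.log 2) ^ 16 * Real.log n ^ 16) := by ring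
    _ = _ := by ring

end PrimeGaps

/-! ### Chebyshev's lower bound for primes in `(n, 2n]` -/

namespace PrimeGaps

open Finset

/-- The primes in `(n, 2n]`. -/
def upperHalfPrimes (n : ℕ) : Finset ℕ := (2 * n).primesLE.filter (n < ·)

/-- Erdős's argument for Bertrand's postulate, keeping the count of primes above `n`. Every prime
power in the binomial is at most `2n`, exponents are at most 1 above `√(2n)`, and no prime in
`(2n/3, n]` occurs. The three factors correspond to `p ≤ √(2n)`, `p ≤ 2n/3` and `n < p`. -/
theorem centralBinom_le_mul_pow_card {n : ℕ} (hn : 2 < n) :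
    n.centralBinom ≤
      (2 * n) ^ Nat.sqrt (2 * n) * 4 ^ (2 * n / 3) * (2 * n) ^ #(upperHalfPrimes n) := by
  have hfac : ∏ p ∈ (2 * n).primesLE, p ^ n.centralBinom.factorization p = n.centralBinom := by
    rw [Nat.primesLE_eq_filter_range, Finset.prod_filter_of_ne,
      Nat.prod_pow_factorization_centralBinom]
    intro p _ h
    contrapose! h
    rw [Nat.factorization_eq_zero_of_not_prime _ h, pow_zero]
  have hterm : ∀ p ∈ (2 * n).primesLE, p ^ n.centralBinom.factorization p ≤
      (if p ≤ Nat.sqrt (2 * n) then 2 * n else 1) * (if p ≤ 2 * n / 3 then p else 1) *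
        (if n < p then 2 * n else 1) := by
    intro p hp
    obtain ⟨hp2n, hpp⟩ := Nat.mem_primesLE.1 hp
    have hbig : p ^ n.centralBinom.factorization p ≤ 2 * n :=
      Nat.pow_factorization_choose_le (by omega)
    have h1 : 1 ≤ (if p ≤ Nat.sqrt (2 * n) then 2 * n else 1) := by split_ifs <;> omega
    have h2 : 1 ≤ (if p ≤ 2 * n / 3 then p else 1) := by
      have := hpp.one_lt; split_ifs <;> omega
    have h3 : 1 ≤ (if n < p then 2 * n else 1) := by split_ifs <;> omega
    by_cases hnp : n < p
    · rw [if_pos hnp]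
      exact hbig.trans (Nat.le_mul_of_pos_left _ (Nat.mul_pos h1 h2))
    refine le_trans ?_ (Nat.le_mul_of_pos_right _ h3)
    by_cases hs : p ≤ Nat.sqrt (2 * n)
    · rw [if_pos hs]
      exact hbig.trans (Nat.le_mul_of_pos_right _ h2)
    refine le_trans ?_ (Nat.le_mul_of_pos_left _ h1)
    by_cases ht : p ≤ 2 * n / 3
    · rw [if_pos ht]
      calc _ ≤ p ^ 1 := Nat.pow_le_pow_right hpp.pos
            (Nat.factorization_choose_le_one (Nat.sqrt_lt'.1 (not_le.1 hs)))
        _ = p := pow_one p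
    · rw [Nat.factorization_centralBinom_of_two_mul_self_lt_three_mul hn (by omega) (by omega),
        pow_zero]
      exact h2
  have hprod := Finset.prod_le_prod' hterm
  rw [hfac, Finset.prod_mul_distrib, Finset.prod_mul_distrib] at hprod
  refine hprod.trans (Nat.mul_le_mul (Nat.mul_le_mul ?_ ?_) ?_)
  · rw [← Finset.prod_filter, Finset.prod_const]
    refine Nat.pow_le_pow_right (by omega) ?_
    refine (Finset.card_le_card (t := Finset.Icc 1 (Nat.sqrt (2 * n))) fun p hp => ?_).trans
      (by simp)
    obtain ⟨h1, h2⟩ := Finset.mem_filter.1 hp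
    exact Finset.mem_Icc.2 ⟨(Nat.prime_of_mem_primesLE h1).pos, h2⟩
  · rw [← Finset.prod_filter]
    refine le_trans ?_ (primorial_le_four_pow (2 * n / 3))
    rw [primorial_eq_prod_primesLE]
    refine Finset.prod_le_prod_of_subset_of_one_le' (fun p hp => ?_) fun p hp _ =>
      (Nat.prime_of_mem_primesLE hp).pos
    obtain ⟨h1, h2⟩ := Finset.mem_filter.1 hp
    exact Nat.mem_primesLE.2 ⟨h2, Nat.prime_of_mem_primesLE h1⟩
  · rw [← Finset.prod_filter, Finset.prod_const]
    exact le_rfl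

open Filter Asymptotics in
theorem eventually_sqrt_mul_log_le :
    ∀ᶠ x : ℝ in atTop, Real.sqrt x * Real.log x + Real.log x ≤ x / 12 := by
  have h1 : (fun x : ℝ => Real.sqrt x * Real.log x) =o[atTop] fun x => x := by
    have := (isBigO_refl (fun x : ℝ => Real.sqrt x) atTop).mul_isLittleO
      (isLittleO_log_rpow_atTop (r := 1 / 2) (by norm_num))
    refine this.congr' EventuallyEq.rfl ?_
    filter_upwards [eventually_ge_atTop 0] with x hx
    rw [← Real.sqrt_eq_rpow, Real.mul_self_sqrt hx]
  have h := (h1.add Real.isLittleO_log_id_atTop).def (c := 1 / 12) (by norm_num)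
  filter_upwards [h, eventually_ge_atTop 0] with x hx hx0
  have := (Real.le_norm_self _).trans hx
  rw [Real.norm_of_nonneg hx0] at this
  linarith

/-- Compare with `4 ^ n < n * centralBinom n`: after the factor `4 ^ (2n/3)`, at least `n/3` is left
on the logarithmic scale. The lower-order terms take at most `n/6` of it, by
`eventually_sqrt_mul_log_le` at `x = 2n`. -/
theorem exists_le_card_upperHalfPrimes :
    ∃ N₀ : ℕ, ∀ n : ℕ, N₀ ≤ n →
      (1 / 6 : ℝ) * n / Real.log (2 * n) ≤ #(upperHalfPrimes n) := by
  obtain ⟨x₀, hx₀⟩ := Filter.eventually_atTop.1 eventually_sqrt_mul_log_le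
  refine ⟨max 4 ⌈x₀⌉₊, fun n hn => ?_⟩
  have hn4 : 4 ≤ n := (le_max_left _ _).trans hn
  have hnx : x₀ ≤ 2 * n := by
    have h1 := Nat.le_ceil x₀
    have h2 : ((⌈x₀⌉₊ : ℕ) : ℝ) ≤ n := by exact_mod_cast (le_max_right _ _).trans hn
    have : (0 : ℝ) ≤ n := Nat.cast_nonneg n
    linarith
  have hasym := hx₀ _ hnx
  have hn0 : (0 : ℝ) < n := by positivity
  have hlog : 0 < Real.log (2 * n) := Real.log_pos (by
    have : (4 : ℝ) ≤ n := by exact_mod_cast hn4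
    linarith)
  have h := (Nat.four_pow_lt_mul_centralBinom n hn4).le.trans
    (Nat.mul_le_mul_left n (centralBinom_le_mul_pow_card (by omega : 2 < n)))
  have h' : (4 : ℝ) ^ n ≤ n * ((2 * n) ^ Nat.sqrt (2 * n) * 4 ^ (2 * n / 3) *
      (2 * n) ^ #(upperHalfPrimes n)) := by exact_mod_cast h
  have hl := Real.log_le_log (by positivity) h'
  rw [Real.log_mul (by positivity) (by positivity), Real.log_mul (by positivity) (by positivity),
    Real.log_mul (by positivity) (by positivity), Real.log_pow, Real.log_pow, Real.log_pow,
    Real.log_pow] at hl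
  have hsq : ((Nat.sqrt (2 * n) : ℕ) : ℝ) ≤ Real.sqrt (2 * n) := by
    exact_mod_cast Real.nat_sqrt_le_real_sqrt (a := 2 * n)
  have hthird : (((2 * n / 3 : ℕ)) : ℝ) ≤ 2 * n / 3 := by
    have := Nat.cast_div_le (α := ℝ) (m := 2 * n) (n := 3); push_cast at this; exact this
  have hl4 : 1 ≤ Real.log 4 := by
    rw [show (4 : ℝ) = 2 ^ 2 by norm_num, Real.log_pow]
    have := Real.log_two_gt_d9; push_cast; linarith
  have hln : Real.log n ≤ Real.log (2 * n) := Real.log_le_log hn0 (by linarith)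
  rw [div_le_iff₀ hlog]
  have e1 := mul_le_mul_of_nonneg_right hsq hlog.le
  have e2 := mul_le_mul_of_nonneg_right hthird (by linarith : 0 ≤ Real.log 4)
  nlinarith

end PrimeGaps

/-! ### Selberg's upper bound sieve -/

namespace PrimeGaps

open Finset ArithmeticFunction
open scoped ArithmeticFunction.Moebius

theorem sum_moebius_divisors (n : ℕ) :
    ∑ d ∈ n.divisors, (μ d : ℝ) = if n = 1 then 1 else 0 := by
  have h : ∑ d ∈ n.divisors, μ d = if n = 1 then 1 else 0 := by
    rw [← coe_mul_zeta_apply, moebius_mul_coe_zeta, one_apply]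
  exact_mod_cast congrArg (Int.cast : ℤ → ℝ) h

/-- Dual Möbius inversion: write `d = l * c` with `c ∣ m / l`; squarefreeness gives `μ (l * c) = μ l
* μ c`. -/
theorem sum_moebius_interval {P l m : ℕ} (hP : Squarefree P) (hm : m ∣ P) :
    ∑ d ∈ P.divisors, (if l ∣ d ∧ d ∣ m then (μ d : ℝ) else 0) =
      if l = m then (μ m : ℝ) else 0 := by
  by_cases hlm : l ∣ m
  · obtain ⟨e, rfl⟩ := hlm
    have hsq : Squarefree (l * e) := hP.squarefree_of_dvd hm
    have hl0 : l ≠ 0 := fun h => hsq.ne_zero (by simp [h])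
    have he0 : e ≠ 0 := fun h => hsq.ne_zero (by simp [h])
    have himg : P.divisors.filter (fun d => l ∣ d ∧ d ∣ l * e) =
        e.divisors.image (l * ·) := by
      ext d
      simp only [mem_filter, Nat.mem_divisors, mem_image]
      constructor
      · rintro ⟨-, ⟨c, rfl⟩, h2⟩
        exact ⟨c, ⟨Nat.dvd_of_mul_dvd_mul_left (Nat.pos_of_ne_zero hl0) h2, he0⟩, rfl⟩
      · rintro ⟨c, ⟨hc, -⟩, rfl⟩
        exact ⟨⟨(mul_dvd_mul_left l hc).trans hm, hP.ne_zero⟩, dvd_mul_right _ _,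
          mul_dvd_mul_left l hc⟩
    rw [← sum_filter, himg, sum_image fun a _ b _ hab => Nat.eq_of_mul_eq_mul_left
      (Nat.pos_of_ne_zero hl0) hab]
    have hmul : ∀ c ∈ e.divisors, (μ (l * c) : ℝ) = μ l * μ c := fun c hc => by
      have hcop : l.Coprime c :=
        (Nat.squarefree_mul_iff.1 hsq).1.coprime_dvd_right (Nat.dvd_of_mem_divisors hc)
      rw [isMultiplicative_moebius.map_mul_of_coprime hcop]
      push_cast; rfl
    rw [sum_congr rfl hmul, ← mul_sum, sum_moebius_divisors]
    by_cases he : e = 1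
    · simp [he]
    · rw [if_neg he, if_neg, mul_zero]
      intro h
      exact he (Nat.eq_of_mul_eq_mul_left (Nat.pos_of_ne_zero hl0) (by rw [mul_one]; exact h.symm))
  · rw [if_neg fun h : l = m => hlm (h ▸ dvd_rfl)]
    exact sum_eq_zero fun d _ => if_neg fun h => hlm (h.1.trans h.2)

section Selberg

variable (s : BoundingSieve) (D : ℕ)

/-- The sum `∑_{l ∣ P, l ≤ D} h(l)` in the main term of Selberg's sieve. -/
noncomputable def selbergSum : ℝ := ∑ l ∈ s.prodPrimes.divisors with l ≤ D, s.selbergTerms l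

/-- Selberg's optimal weights of level `D`. -/
noncomputable def selbergWeight (d : ℕ) : ℝ :=
  (s.nu d)⁻¹ * (μ d * ∑ m ∈ s.prodPrimes.divisors with d ∣ m ∧ m ≤ D, s.selbergTerms m) /
    selbergSum s D

variable {s D}

theorem selbergTerms_pos_of_mem {l : ℕ} (hl : l ∈ s.prodPrimes.divisors) :
    0 < s.selbergTerms l :=
  BoundingSieve.selbergTerms_pos (Nat.dvd_of_mem_divisors hl)

theorem one_le_selbergSum (hD : 1 ≤ D) : 1 ≤ selbergSum s D := by
  have h1 : s.selbergTerms 1 = 1 := BoundingSieve.selbergTerms_isMultiplicative.map_one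
  rw [← h1]
  refine single_le_sum (f := fun l => s.selbergTerms l)
    (fun l hl => (selbergTerms_pos_of_mem (mem_filter.1 hl).1).le) ?_
  exact mem_filter.2 ⟨Nat.one_mem_divisors.2 s.prodPrimes_squarefree.ne_zero, hD⟩

theorem selbergWeight_one (hD : 1 ≤ D) : selbergWeight s D 1 = 1 := by
  have h := one_le_selbergSum (s := s) hD
  have h2 : ∑ m ∈ s.prodPrimes.divisors with 1 ∣ m ∧ m ≤ D, s.selbergTerms m =
      selbergSum s D := by simp [selbergSum]
  rw [selbergWeight, h2, s.nu_mult.map_one]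
  simp only [moebius_apply_one, Int.cast_one, inv_one, one_mul]
  exact div_self (by linarith)

/-- The weights are a Möbius inversion of these linear forms, which diagonalise Selberg's quadratic
form; inverting back recovers the optimal values, supported on `l ≤ D`. -/
theorem sum_nu_mul_selbergWeight {l : ℕ} :
    ∑ d ∈ s.prodPrimes.divisors, (if l ∣ d then s.nu d * selbergWeight s D d else 0) =
      ∑ m ∈ s.prodPrimes.divisors with m ≤ D,
        if l = m then μ m * s.selbergTerms m / selbergSum s D else 0 := by
  have hterm : ∀ d ∈ s.prodPrimes.divisors,
      (if l ∣ d then s.nu d * selbergWeight s D d else 0) =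
        ∑ m ∈ s.prodPrimes.divisors with m ≤ D,
          s.selbergTerms m / selbergSum s D * (if l ∣ d ∧ d ∣ m then (μ d : ℝ) else 0) := by
    intro d hd
    have hnu := BoundingSieve.nu_ne_zero (Nat.dvd_of_mem_divisors hd)
    by_cases hld : l ∣ d
    · have : ∑ m ∈ s.prodPrimes.divisors with d ∣ m ∧ m ≤ D, s.selbergTerms m =
          ∑ m ∈ s.prodPrimes.divisors with m ≤ D, if d ∣ m then s.selbergTerms m else 0 := by
        rw [← sum_filter, filter_filter]
        exact sum_congr (filter_congr fun m _ => and_comm) fun _ _ => rfl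
      rw [if_pos hld, selbergWeight, this, mul_div_assoc, ← mul_assoc, mul_inv_cancel₀ hnu,
        one_mul, mul_sum, sum_div]
      refine sum_congr rfl fun m _ => ?_
      by_cases hdm : d ∣ m
      · rw [if_pos hdm, if_pos ⟨hld, hdm⟩]; ring
      · rw [if_neg hdm, if_neg fun h => hdm h.2]; ring
    · rw [if_neg hld]
      exact (sum_eq_zero fun m _ => by rw [if_neg fun h => hld h.1, mul_zero]).symm
  rw [sum_congr rfl hterm, sum_comm]
  refine sum_congr rfl fun m hm => ?_
  rw [← mul_sum, sum_moebius_interval s.prodPrimes_squarefree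
    (Nat.dvd_of_mem_divisors (mem_filter.1 hm).1)]
  split_ifs <;> ring

/-- With `G = selbergSum s D`, each `l ≤ D` contributes `h(l)⁻¹ (h(l) / G)²` to the diagonalised
form, and these add up to `G / G²`. -/
theorem mainSum_selbergWeight (hD : 1 ≤ D) :
    s.mainSum (BoundingSieve.lambdaSquared (selbergWeight s D)) = (selbergSum s D)⁻¹ := by
  have hG := one_le_selbergSum (s := s) hD
  rw [BoundingSieve.mainSum_lambdaSquared_eq_sum_mul_sum_sq]
  have hterm : ∀ l ∈ s.prodPrimes.divisors, (s.selbergTerms l)⁻¹ *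
      (∑ d ∈ s.prodPrimes.divisors, if l ∣ d then s.nu d * selbergWeight s D d else 0) ^ 2 =
        (if l ≤ D then s.selbergTerms l else 0) * ((selbergSum s D)⁻¹ ^ 2) := by
    intro l hl
    have hpos := selbergTerms_pos_of_mem hl
    rw [sum_nu_mul_selbergWeight, sum_ite_eq]
    have hmu : (μ l : ℝ) ^ 2 = 1 := by
      exact_mod_cast moebius_sq_eq_one_of_squarefree
        (BoundingSieve.squarefree_of_mem_divisors_prodPrimes hl)
    by_cases hlD : l ≤ D
    · rw [if_pos (mem_filter.2 ⟨hl, hlD⟩), if_pos hlD]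
      calc _ = (s.selbergTerms l)⁻¹ * ((μ l : ℝ) ^ 2 * s.selbergTerms l ^ 2 *
            (selbergSum s D)⁻¹ ^ 2) := by ring
        _ = _ := by rw [hmu]; field_simp
    · have hmem : l ∉ {m ∈ s.prodPrimes.divisors | m ≤ D} := fun h => hlD (mem_filter.1 h).2
      rw [if_neg hmem, if_neg hlD]; ring
  rw [sum_congr rfl hterm, ← sum_mul, ← sum_filter]
  change selbergSum s D * _ = _
  field_simp

theorem selbergWeight_eq_zero {d : ℕ} (hd : D < d) : selbergWeight s D d = 0 := by
  have : ∑ m ∈ s.prodPrimes.divisors with d ∣ m ∧ m ≤ D, s.selbergTerms m = 0 := by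
    refine sum_eq_zero fun m hm => ?_
    obtain ⟨hm, hdm, hmD⟩ := mem_filter.1 hm
    exact absurd (Nat.le_of_dvd (Nat.pos_of_mem_divisors hm) hdm) (by omega)
  rw [selbergWeight, this]; simp

/-- The inner sum is part of `selbergSum`, so the weight is at most `ν(d)⁻¹ ≤ d ≤ D`. This crude
bound suffices, since the level will be a small power of `X`. -/
theorem abs_selbergWeight_le (hD : 1 ≤ D)
    (hnu : ∀ d, d ∣ s.prodPrimes → (1 : ℝ) ≤ d * s.nu d) {d : ℕ} (hd : d ∣ s.prodPrimes) :
    |selbergWeight s D d| ≤ D := by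
  rcases lt_or_ge D d with h | h
  · rw [selbergWeight_eq_zero h, abs_zero]; exact Nat.cast_nonneg D
  have hG := one_le_selbergSum (s := s) hD
  have hnu0 := BoundingSieve.nu_pos_of_dvd_prodPrimes hd
  have hsum0 : 0 ≤ ∑ m ∈ s.prodPrimes.divisors with d ∣ m ∧ m ≤ D, s.selbergTerms m :=
    sum_nonneg fun l hl => (selbergTerms_pos_of_mem (mem_filter.1 hl).1).le
  have hsum : ∑ m ∈ s.prodPrimes.divisors with d ∣ m ∧ m ≤ D, s.selbergTerms m ≤
      selbergSum s D :=
    sum_le_sum_of_subset_of_nonneg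
      (fun m hm => mem_filter.2 ⟨(mem_filter.1 hm).1, (mem_filter.1 hm).2.2⟩)
      fun l hl _ => (selbergTerms_pos_of_mem (mem_filter.1 hl).1).le
  have hmu : |(μ d : ℝ)| = 1 := by
    exact_mod_cast abs_moebius_eq_one_of_squarefree
      (BoundingSieve.squarefree_of_dvd_prodPrimes hd)
  rw [selbergWeight, abs_div, abs_mul, abs_mul, hmu, one_mul, abs_of_nonneg hsum0,
    abs_of_pos (inv_pos.2 hnu0), abs_of_pos (by linarith : 0 < selbergSum s D),
    div_le_iff₀ (by linarith)]
  refine mul_le_mul ?_ hsum hsum0 (Nat.cast_nonneg D)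
  rw [inv_le_iff_one_le_mul₀ hnu0]
  calc (1 : ℝ) ≤ d * s.nu d := hnu d hd
    _ ≤ D * s.nu d := by gcongr

theorem lambdaSquared_selbergWeight_eq_zero {d : ℕ} (hd : D ^ 2 < d) :
    BoundingSieve.lambdaSquared (selbergWeight s D) d = 0 := by
  refine sum_eq_zero fun d1 hd1 => sum_eq_zero fun d2 hd2 => ?_
  split_ifs with h
  · rcases lt_or_ge D d1 with h1 | h1
    · rw [selbergWeight_eq_zero h1, zero_mul]
    rcases lt_or_ge D d2 with h2 | h2
    · rw [selbergWeight_eq_zero h2, mul_zero]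
    have := (Nat.lcm_le_mul (Nat.pos_of_mem_divisors hd1) (Nat.pos_of_mem_divisors hd2)).trans (Nat.mul_le_mul h1 h2)
    rw [← h, ← sq] at this
    omega
  · rfl

theorem abs_lambdaSquared_selbergWeight_le (hD : 1 ≤ D)
    (hnu : ∀ d, d ∣ s.prodPrimes → (1 : ℝ) ≤ d * s.nu d) {d : ℕ} (hd : d ∣ s.prodPrimes) :
    |BoundingSieve.lambdaSquared (selbergWeight s D) d| ≤ (d : ℝ) ^ 2 * (D : ℝ) ^ 2 := by
  have hterm : ∀ d1 ∈ d.divisors, ∀ d2 ∈ d.divisors,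
      |if d = Nat.lcm d1 d2 then selbergWeight s D d1 * selbergWeight s D d2 else 0| ≤
        (D : ℝ) ^ 2 := by
    intro d1 h1 d2 h2
    split_ifs
    · rw [abs_mul, sq]
      exact mul_le_mul (abs_selbergWeight_le hD hnu ((Nat.dvd_of_mem_divisors h1).trans hd))
        (abs_selbergWeight_le hD hnu ((Nat.dvd_of_mem_divisors h2).trans hd)) (abs_nonneg _)
        (Nat.cast_nonneg D)
    · rw [abs_zero]; positivity
  have hcard : ((#d.divisors : ℕ) : ℝ) ≤ d := by exact_mod_cast Nat.card_divisors_le_self d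
  calc _ ≤ ∑ d1 ∈ d.divisors, ∑ d2 ∈ d.divisors, (D : ℝ) ^ 2 :=
        (abs_sum_le_sum_abs _ _).trans (sum_le_sum fun d1 h1 =>
          (abs_sum_le_sum_abs _ _).trans (sum_le_sum fun d2 h2 => hterm d1 h1 d2 h2))
    _ = (#d.divisors : ℝ) ^ 2 * (D : ℝ) ^ 2 := by
        simp only [sum_const, nsmul_eq_mul]; ring
    _ ≤ _ := by gcongr

/-- Selberg's upper bound sieve, with a crude polynomial error term. -/
theorem siftedSum_le_div_selbergSum_add (hD : 1 ≤ D)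
    (hnu : ∀ d, d ∣ s.prodPrimes → (1 : ℝ) ≤ d * s.nu d)
    (hrem : ∀ d, d ∣ s.prodPrimes → |s.rem d| ≤ d) :
    s.siftedSum ≤ s.totalMass / selbergSum s D + (D : ℝ) ^ 10 := by
  have h := BoundingSieve.siftedSum_le_mainSum_errSum_of_upperMoebius (s := s) _
    (BoundingSieve.upperMoebius_lambdaSquared _ (selbergWeight_one (s := s) hD))
  rw [mainSum_selbergWeight hD, ← div_eq_mul_inv] at h
  refine h.trans (add_le_add_right ?_ _)
  -- Only `d ≤ D²` contribute, each at most `d² D² · d ≤ D ^ 8`, and there are at most `D²` of them.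
  have h1 : s.errSum (BoundingSieve.lambdaSquared (selbergWeight s D)) ≤
      ∑ d ∈ s.prodPrimes.divisors, if d ≤ D ^ 2 then (D : ℝ) ^ 8 else 0 := by
    refine sum_le_sum fun d hd => ?_
    have hdP := Nat.dvd_of_mem_divisors hd
    split_ifs with hle
    · have hle' : (d : ℝ) ≤ (D : ℝ) ^ 2 := by exact_mod_cast hle
      calc _ ≤ ((d : ℝ) ^ 2 * (D : ℝ) ^ 2) * d :=
            mul_le_mul (abs_lambdaSquared_selbergWeight_le hD hnu hdP) (hrem d hdP)
              (abs_nonneg _) (by positivity)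
        _ ≤ (((D : ℝ) ^ 2) ^ 2 * (D : ℝ) ^ 2) * (D : ℝ) ^ 2 := by gcongr
        _ = _ := by ring
    · rw [lambdaSquared_selbergWeight_eq_zero (not_le.1 hle), abs_zero, zero_mul]
  refine h1.trans ?_
  rw [← sum_filter, sum_const, nsmul_eq_mul]
  have hc : #{d ∈ s.prodPrimes.divisors | d ≤ D ^ 2} ≤ D ^ 2 := by
    refine (card_le_card (t := Icc 1 (D ^ 2)) fun d hd => ?_).trans (by simp)
    exact mem_Icc.2 ⟨Nat.pos_of_mem_divisors (mem_filter.1 hd).1, (mem_filter.1 hd).2⟩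
  have hc' : ((#{d ∈ s.prodPrimes.divisors | d ≤ D ^ 2} : ℕ) : ℝ) ≤ (D : ℝ) ^ 2 := by
    exact_mod_cast hc
  calc _ ≤ (D : ℝ) ^ 2 * (D : ℝ) ^ 8 := by gcongr
    _ = _ := by ring

end Selberg

end PrimeGaps

/-! ### Rankin's trick for Selberg's sum -/

namespace PrimeGaps

open Finset ArithmeticFunction

/-- The function `n ↦ n ^ δ` as an arithmetic function. -/
noncomputable def rpowFunction (δ : ℝ) (hδ : δ ≠ 0) : ArithmeticFunction ℝ :=
  ⟨fun n => (n : ℝ) ^ δ, by simp [Real.zero_rpow hδ]⟩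

theorem isMultiplicative_rpowFunction (δ : ℝ) (hδ : δ ≠ 0) :
    (rpowFunction δ hδ).IsMultiplicative := by
  constructor
  · change ((1 : ℕ) : ℝ) ^ δ = 1
    simp
  · intro m n _
    change ((m * n : ℕ) : ℝ) ^ δ = (m : ℝ) ^ δ * (n : ℝ) ^ δ
    push_cast
    exact Real.mul_rpow (Nat.cast_nonneg m) (Nat.cast_nonneg n)

theorem selbergTerms_prime {s : BoundingSieve} {p : ℕ} (hp : p.Prime) :
    s.selbergTerms p = s.nu p * (1 - s.nu p)⁻¹ := by
  rw [BoundingSieve.selbergTerms_apply, hp.primeFactors, prod_singleton]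

/-- Rankin's trick: a lower bound for Selberg's sum when all sifting primes are small
compared with the level. -/
theorem half_prod_inv_le_selbergSum {s : BoundingSieve} {z k D : ℕ} (hz : 2 ≤ z)
    (hP : s.prodPrimes = primorial z)
    (hnu : ∀ p ∈ z.primesLE, s.nu p ≤ k / p) (hD : z ^ (6 * k + 1) ≤ D) :
    (1 / 2 : ℝ) * ∏ p ∈ z.primesLE, (1 - s.nu p)⁻¹ ≤ selbergSum s D := by
  have hlz : 0 < Real.log z := Real.log_pos (by exact_mod_cast hz)
  -- Rankin's exponent: `δ log p ≤ 1` for all `p ≤ z`, so `p ^ δ ≤ 1 + 2 δ log p`.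
  set δ : ℝ := (Real.log z)⁻¹ with hδ
  have hδ0 : 0 < δ := inv_pos.2 hlz
  have hpf : s.prodPrimes.primeFactors = z.primesLE := by rw [hP, primeFactors_primorial]
  have hnu0 : ∀ p ∈ z.primesLE, 0 < s.nu p ∧ s.nu p < 1 := fun p hp => by
    have hdvd : p ∣ s.prodPrimes := Nat.dvd_of_mem_primeFactors (hpf ▸ hp)
    exact ⟨s.nu_pos_of_prime p (Nat.prime_of_mem_primesLE hp) hdvd,
      s.nu_lt_one_of_prime p (Nat.prime_of_mem_primesLE hp) hdvd⟩
  have hsq := s.prodPrimes_squarefree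
  have hall : ∑ l ∈ s.prodPrimes.divisors, s.selbergTerms l =
      ∏ p ∈ z.primesLE, (1 - s.nu p)⁻¹ := by
    rw [← BoundingSieve.selbergTerms_isMultiplicative.prodPrimeFactors_one_add_of_squarefree hsq,
      hpf]
    refine prod_congr rfl fun p hp => ?_
    have := hnu0 p hp
    rw [selbergTerms_prime (Nat.prime_of_mem_primesLE hp)]
    have h1 : 1 - s.nu p ≠ 0 := by linarith
    field_simp
    ring
  have hmul : (s.selbergTerms.pmul (rpowFunction δ hδ0.ne')).IsMultiplicative :=
    BoundingSieve.selbergTerms_isMultiplicative.pmul (isMultiplicative_rpowFunction δ hδ0.ne')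
  have happly : ∀ n : ℕ, s.selbergTerms.pmul (rpowFunction δ hδ0.ne') n =
      s.selbergTerms n * (n : ℝ) ^ δ := fun n => by rw [pmul_apply]; rfl
  -- The weight `l ^ δ` inflates the complete sum by at most `exp (6k)`, where `6 = 2 · 3` comes
  -- from `p ^ δ - 1 ≤ 2 δ log p` and `∑ log p / p ≤ 3 log z`.
  have hmoment : ∑ l ∈ s.prodPrimes.divisors, s.selbergTerms l * (l : ℝ) ^ δ ≤
      (∏ p ∈ z.primesLE, (1 - s.nu p)⁻¹) * Real.exp (6 * k) := by
    simp only [← happly]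
    rw [← hmul.prodPrimeFactors_one_add_of_squarefree hsq, hpf]
    have hfac : ∀ p ∈ z.primesLE, 1 + s.selbergTerms.pmul (rpowFunction δ hδ0.ne') p ≤
        (1 - s.nu p)⁻¹ * Real.exp (2 * δ * k * (Real.log p / p)) := by
      intro p hp
      obtain ⟨h0, h1⟩ := hnu0 p hp
      have hpp := Nat.prime_of_mem_primesLE hp
      have hp0 : (0 : ℝ) < p := by exact_mod_cast hpp.pos
      have hlp0 : 0 ≤ Real.log p := Real.log_natCast_nonneg p
      have hx1 : δ * Real.log p ≤ 1 := by
        rw [hδ, inv_mul_le_iff₀ hlz, mul_one]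
        exact Real.log_le_log hp0 (by exact_mod_cast Nat.le_of_mem_primesLE hp)
      have hx0 : 0 ≤ δ * Real.log p := by positivity
      have hpow : (p : ℝ) ^ δ ≤ 1 + 2 * (δ * Real.log p) := by
        rw [Real.rpow_def_of_pos hp0, mul_comm]
        have := Real.abs_exp_sub_one_le (x := δ * Real.log p) (by rwa [abs_of_nonneg hx0])
        rw [abs_of_nonneg hx0] at this
        linarith [le_abs_self (Real.exp (δ * Real.log p) - 1)]
      have hne : 1 - s.nu p ≠ 0 := by linarith
      have heq : 1 + s.selbergTerms.pmul (rpowFunction δ hδ0.ne') p =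
          (1 - s.nu p)⁻¹ * (1 + s.nu p * ((p : ℝ) ^ δ - 1)) := by
        rw [happly, selbergTerms_prime hpp]
        field_simp
        ring
      rw [heq]
      refine mul_le_mul_of_nonneg_left ?_ (inv_nonneg.2 (by linarith))
      have hstep : s.nu p * ((p : ℝ) ^ δ - 1) ≤ 2 * δ * k * (Real.log p / p) :=
        calc s.nu p * ((p : ℝ) ^ δ - 1) ≤ s.nu p * (2 * (δ * Real.log p)) :=
              mul_le_mul_of_nonneg_left (by linarith) h0.le
          _ ≤ k / p * (2 * (δ * Real.log p)) :=
              mul_le_mul_of_nonneg_right (hnu p hp) (by positivity)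
          _ = _ := by ring
      linarith [Real.add_one_le_exp (2 * δ * k * (Real.log p / p))]
    refine (prod_le_prod (fun p hp => ?_) hfac).trans ?_
    · rw [happly, selbergTerms_prime (Nat.prime_of_mem_primesLE hp)]
      obtain ⟨h0, h1⟩ := hnu0 p hp
      have : 0 ≤ (1 - s.nu p)⁻¹ := inv_nonneg.2 (by linarith)
      positivity
    · rw [prod_mul_distrib, ← Real.exp_sum, ← mul_sum]
      refine mul_le_mul_of_nonneg_left (Real.exp_le_exp.2 ?_)
        (prod_nonneg fun p hp => inv_nonneg.2 (by linarith [(hnu0 p hp).2]))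
      have hM := sum_log_div_primesLE_le z
      have h4 : Real.log 4 ≤ 2 * Real.log z := by
        rw [show (4 : ℝ) = 2 ^ 2 by norm_num, Real.log_pow]
        have := Real.log_le_log two_pos (by exact_mod_cast hz : (2 : ℝ) ≤ z)
        push_cast; linarith
      calc 2 * δ * k * ∑ p ∈ z.primesLE, Real.log p / p
          ≤ 2 * δ * k * (3 * Real.log z) := by gcongr; linarith
        _ = 6 * k * (δ * Real.log z) := by ring
        _ = 6 * k := by rw [hδ, inv_mul_cancel₀ hlz.ne', mul_one]
  -- The extra 1 in the exponent makes the terms with `l > D` at most `1/e < 1/2` of the complete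
  -- sum.
  have hDpow : Real.exp (6 * k + 1) ≤ (D : ℝ) ^ δ := by
    have hz0 : (0 : ℝ) < z := by positivity
    have h1 : (z : ℝ) ^ (6 * k + 1) ≤ D := by exact_mod_cast hD
    calc Real.exp (6 * k + 1) = ((z : ℝ) ^ (6 * k + 1)) ^ δ := by
          rw [Real.rpow_def_of_pos (by positivity), Real.log_pow, hδ, mul_assoc,
            mul_inv_cancel₀ hlz.ne']
          push_cast; ring_nf
      _ ≤ _ := Real.rpow_le_rpow (by positivity) h1 hδ0.le
  have htail : ∑ l ∈ s.prodPrimes.divisors with ¬ l ≤ D, s.selbergTerms l ≤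
      (1 / 2 : ℝ) * ∏ p ∈ z.primesLE, (1 - s.nu p)⁻¹ := by
    have hprod0 : 0 ≤ ∏ p ∈ z.primesLE, (1 - s.nu p)⁻¹ :=
      prod_nonneg fun p hp => inv_nonneg.2 (by linarith [(hnu0 p hp).2])
    have h1 : (∑ l ∈ s.prodPrimes.divisors with ¬ l ≤ D, s.selbergTerms l) *
        Real.exp (6 * k + 1) ≤ (∏ p ∈ z.primesLE, (1 - s.nu p)⁻¹) * Real.exp (6 * k) := by
      rw [sum_mul]
      refine le_trans ?_ hmoment
      refine (sum_le_sum fun l hl => ?_).trans (sum_le_sum_of_subset_of_nonneg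
        (filter_subset (fun l => ¬ l ≤ D) _) fun l hl _ => ?_)
      · obtain ⟨hl, hlD⟩ := mem_filter.1 hl
        refine mul_le_mul_of_nonneg_left (hDpow.trans ?_) (selbergTerms_pos_of_mem hl).le
        exact Real.rpow_le_rpow (Nat.cast_nonneg D) (by exact_mod_cast (not_le.1 hlD).le) hδ0.le
      · have := selbergTerms_pos_of_mem hl
        positivity
    have h2 : 2 * Real.exp (6 * k) ≤ Real.exp (6 * k + 1) := by
      rw [Real.exp_add, mul_comm]
      have := Real.exp_one_gt_d9
      gcongr
      linarith
    have h3 := Real.exp_pos (6 * (k : ℝ))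
    have h0 : 0 ≤ ∑ l ∈ s.prodPrimes.divisors with ¬ l ≤ D, s.selbergTerms l :=
      sum_nonneg fun l hl => (selbergTerms_pos_of_mem (mem_filter.1 hl).1).le
    have h4 : (2 * ∑ l ∈ s.prodPrimes.divisors with ¬ l ≤ D, s.selbergTerms l) *
        Real.exp (6 * k) ≤ (∏ p ∈ z.primesLE, (1 - s.nu p)⁻¹) * Real.exp (6 * k) := by
      nlinarith
    linarith [le_of_mul_le_mul_right h4 h3]
  have hsplit := sum_filter_add_sum_filter_not s.prodPrimes.divisors (· ≤ D) s.selbergTerms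
  rw [hall] at hsplit
  have : selbergSum s D = ∑ l ∈ s.prodPrimes.divisors with l ≤ D, s.selbergTerms l := rfl
  linarith

end PrimeGaps

/-! ### The sieve applied to `∏ (n + h)` -/

namespace PrimeGaps

open Finset ArithmeticFunction

theorem selbergTerms_le_self {s : BoundingSieve}
    (hnu : ∀ p, p.Prime → p ∣ s.prodPrimes → s.nu p ≤ 1 - 1 / p) {l : ℕ}
    (hl : l ∣ s.prodPrimes) : s.selbergTerms l ≤ l := by
  have hsq := BoundingSieve.squarefree_of_dvd_prodPrimes hl
  have h1 : ∏ p ∈ l.primeFactors, s.selbergTerms p = s.selbergTerms l := by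
    rw [← BoundingSieve.selbergTerms_isMultiplicative.map_prod_of_subset_primeFactors _ _
      subset_rfl, Nat.prod_primeFactors_of_squarefree hsq]
  have h2 : ((∏ p ∈ l.primeFactors, p : ℕ) : ℝ) = l := by
    rw [Nat.prod_primeFactors_of_squarefree hsq]
  rw [← h1, ← h2, Nat.cast_prod]
  refine prod_le_prod (fun p hp => ?_) fun p hp => ?_
  · exact (BoundingSieve.selbergTerms_pos ((Nat.dvd_of_mem_primeFactors hp).trans hl)).le
  · have hpp := Nat.prime_of_mem_primeFactors hp
    have hdvd := (Nat.dvd_of_mem_primeFactors hp).trans hl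
    have hp0 : (0 : ℝ) < p := by exact_mod_cast hpp.pos
    have hlt := s.nu_lt_one_of_prime p hpp hdvd
    have hle := hnu p hpp hdvd
    have h3 : (1 - s.nu p)⁻¹ ≤ p := by
      rw [inv_le_comm₀ (by linarith) hp0, ← one_div]
      linarith
    rw [selbergTerms_prime hpp]
    calc s.nu p * (1 - s.nu p)⁻¹ ≤ 1 * p :=
          mul_le_mul hlt.le h3 (inv_nonneg.2 (by linarith)) zero_le_one
      _ = p := one_mul _

/-- Used to absorb the additive sieve error: an upper bound for Selberg's sum forces a lower bound
for the sieve product. -/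
theorem selbergSum_le_sq {s : BoundingSieve} {D : ℕ}
    (hnu : ∀ p, p.Prime → p ∣ s.prodPrimes → s.nu p ≤ 1 - 1 / p) :
    selbergSum s D ≤ (D : ℝ) ^ 2 := by
  have h1 : selbergSum s D ≤ ∑ l ∈ s.prodPrimes.divisors with l ≤ D, (D : ℝ) :=
    sum_le_sum fun l hl => (selbergTerms_le_self hnu
      (Nat.dvd_of_mem_divisors (mem_filter.1 hl).1)).trans (by exact_mod_cast (mem_filter.1 hl).2)
  refine h1.trans ?_
  rw [sum_const, nsmul_eq_mul, sq]
  have hc : #{d ∈ s.prodPrimes.divisors | d ≤ D} ≤ D := by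
    refine (card_le_card (t := Icc 1 D) fun d hd => ?_).trans (by simp)
    exact mem_Icc.2 ⟨Nat.pos_of_mem_divisors (mem_filter.1 hd).1, (mem_filter.1 hd).2⟩
  have hc' : ((#{d ∈ s.prodPrimes.divisors | d ≤ D} : ℕ) : ℝ) ≤ D := by exact_mod_cast hc
  gcongr

/-- The value `∏_{h ∈ H} (n + h)`. -/
def shiftProd (H : Finset ℕ) (n : ℕ) : ℕ := ∏ h ∈ H, (n + h)

/-- The number of solutions modulo `d` of `∏_{h ∈ H} (n + h) ≡ 0`. -/
def rootCount (H : Finset ℕ) (d : ℕ) : ℕ := #{r ∈ range d | d ∣ shiftProd H r}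

theorem shiftProd_modEq (H : Finset ℕ) {a b d : ℕ} (h : a ≡ b [MOD d]) :
    shiftProd H a ≡ shiftProd H b [MOD d] := by
  unfold shiftProd
  induction H using Finset.induction_on with
  | empty => exact Nat.ModEq.refl _
  | insert x s hx ih => rw [prod_insert hx, prod_insert hx]; exact (h.add_right x).mul ih

theorem dvd_shiftProd_iff (H : Finset ℕ) {a b d : ℕ} (h : a ≡ b [MOD d]) :
    d ∣ shiftProd H a ↔ d ∣ shiftProd H b :=
  (shiftProd_modEq H h).dvd_iff dvd_rfl

theorem rootCount_le (H : Finset ℕ) (d : ℕ) : rootCount H d ≤ d :=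
  (card_filter_le _ _).trans (card_range d).le

theorem rootCount_one (H : Finset ℕ) : rootCount H 1 = 1 := by
  simp [rootCount]

/-- Chinese remainder theorem, as an explicit bijection on least residues. -/
theorem rootCount_mul (H : Finset ℕ) {m n : ℕ} (h : m.Coprime n) :
    rootCount H (m * n) = rootCount H m * rootCount H n := by
  rcases m.eq_zero_or_pos with rfl | hm
  · simp [rootCount]
  rcases n.eq_zero_or_pos with rfl | hn
  · simp [rootCount]
  rw [rootCount, rootCount, rootCount, ← card_product]
  refine card_bij' (fun r _ => (r % m, r % n))
    (fun x _ => (Nat.chineseRemainder h x.1 x.2 : ℕ)) ?_ ?_ ?_ ?_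
  · intro r hr
    obtain ⟨-, hd⟩ := mem_filter.1 hr
    rw [mem_product]
    refine ⟨mem_filter.2 ⟨mem_range.2 (Nat.mod_lt _ hm), ?_⟩,
      mem_filter.2 ⟨mem_range.2 (Nat.mod_lt _ hn), ?_⟩⟩
    · exact (dvd_shiftProd_iff H (Nat.mod_modEq r m)).2 ((dvd_mul_right m n).trans hd)
    · exact (dvd_shiftProd_iff H (Nat.mod_modEq r n)).2 ((dvd_mul_left n m).trans hd)
  · intro x hx
    obtain ⟨h1, h2⟩ := mem_product.1 hx
    have e := (Nat.chineseRemainder h x.1 x.2).2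
    refine mem_filter.2 ⟨mem_range.2 (Nat.chineseRemainder_lt_mul h _ _ hm.ne' hn.ne'),
      h.mul_dvd_of_dvd_of_dvd ?_ ?_⟩
    · exact (dvd_shiftProd_iff H e.1).2 (mem_filter.1 h1).2
    · exact (dvd_shiftProd_iff H e.2).2 (mem_filter.1 h2).2
  · intro r hr
    have hlt := mem_range.1 (mem_filter.1 hr).1
    have e := (Nat.chineseRemainder h (r % m) (r % n)).2
    have := (Nat.modEq_and_modEq_iff_modEq_mul h).1
      ⟨e.1.trans (Nat.mod_modEq r m), e.2.trans (Nat.mod_modEq r n)⟩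
    exact Nat.ModEq.eq_of_lt_of_lt this (Nat.chineseRemainder_lt_mul h _ _ hm.ne' hn.ne') hlt
  · intro x hx
    obtain ⟨h1, h2⟩ := mem_product.1 hx
    have e := (Nat.chineseRemainder h x.1 x.2).2
    have l1 := mem_range.1 (mem_filter.1 h1).1
    have l2 := mem_range.1 (mem_filter.1 h2).1
    refine Prod.ext ?_ ?_
    · exact Eq.trans e.1 (Nat.mod_eq_of_lt l1)
    · exact Eq.trans e.2 (Nat.mod_eq_of_lt l2)

/-- Negation modulo `p` exchanges the roots with the classes occupied by `H`; the outer `% p` takes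
care of the class 0. -/
theorem rootCount_prime (H : Finset ℕ) {p : ℕ} (hp : p.Prime) :
    rootCount H p = residueCount H p := by
  rw [rootCount, residueCount]
  symm
  refine card_bij' (fun a _ => (p - a) % p) (fun r _ => (p - r) % p) ?_ ?_ ?_ ?_
  · intro a ha
    obtain ⟨h, hh, rfl⟩ := mem_image.1 ha
    have hlt := Nat.mod_lt h hp.pos
    refine mem_filter.2 ⟨mem_range.2 (Nat.mod_lt _ hp.pos), ?_⟩
    refine (dvd_shiftProd_iff H (Nat.mod_modEq _ p)).2 (dvd_trans ?_ (dvd_prod_of_mem _ hh))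
    have : (p - h % p + h) ≡ (p - h % p + h % p) [MOD p] :=
      Nat.ModEq.add_left _ (Nat.mod_modEq h p).symm
    rw [Nat.sub_add_cancel hlt.le] at this
    exact (this.dvd_iff dvd_rfl).2 dvd_rfl
  · intro r hr
    obtain ⟨hr1, hr2⟩ := mem_filter.1 hr
    have hlt := mem_range.1 hr1
    obtain ⟨h, hh, hd⟩ := (hp.prime.dvd_finsetProd_iff _).1 hr2
    refine mem_image.2 ⟨h, hh, ?_⟩
    refine Nat.ModEq.add_left_cancel' r ?_
    rw [Nat.add_sub_cancel' hlt.le]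
    exact (Nat.modEq_zero_iff_dvd.2 hd).trans (Nat.modEq_zero_iff_dvd.2 dvd_rfl).symm
  · intro a ha
    obtain ⟨h, -, rfl⟩ := mem_image.1 ha
    have hlt := Nat.mod_lt h hp.pos
    generalize h % p = b at hlt
    rcases b.eq_zero_or_pos with rfl | hb
    · simp
    · rw [Nat.mod_eq_of_lt (by omega : p - b < p), Nat.sub_sub_self hlt.le, Nat.mod_eq_of_lt hlt]
  · intro b hr
    have hlt := mem_range.1 (mem_filter.1 hr).1
    rcases b.eq_zero_or_pos with rfl | hb
    · simp
    · change (p - (p - b) % p) % p = b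
      rw [Nat.mod_eq_of_lt (by omega : p - b < p), Nat.sub_sub_self hlt.le, Nat.mod_eq_of_lt hlt]

theorem card_filter_Ico_mul_of_periodic {d : ℕ} (P : ℕ → Prop) [DecidablePred P]
    (hP : Function.Periodic P d) (a q : ℕ) :
    #{n ∈ Ico a (a + q * d) | P n} = q * d.count P := by
  induction q with
  | zero => simp
  | succ q ih =>
    have hsplit : Ico a (a + (q + 1) * d) =
        Ico a (a + q * d) ∪ Ico (a + q * d) (a + q * d + d) := by
      rw [Ico_union_Ico_eq_Ico (by omega) (by omega)]; congr 1; ring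
    rw [hsplit, filter_union, card_union_of_disjoint, ih, Nat.filter_Ico_card_eq_of_periodic _ _ _ hP]
    · ring
    · exact disjoint_filter_filter (Ico_disjoint_Ico_consecutive _ _ _)

/-- The interval lies between `N / d` and `N / d + 1` full periods, each holding `rootCount H d ≤ d`
solutions. The bound does not depend on the size of the shifts. -/
theorem abs_card_filter_dvd_sub_le (H : Finset ℕ) {d : ℕ} (hd : 0 < d) (a N : ℕ) :
    |(#{n ∈ Ico a (a + N) | d ∣ shiftProd H n} : ℝ) - rootCount H d / d * N| ≤ d := by
  have hper : Function.Periodic (fun n => d ∣ shiftProd H n) d := fun n =>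
    propext (dvd_shiftProd_iff H (by simp [Nat.ModEq]))
  have hcount : d.count (fun n => d ∣ shiftProd H n) = rootCount H d := by
    rw [Nat.count_eq_card_filter_range, rootCount]
  have h1 := card_filter_Ico_mul_of_periodic _ hper a (N / d)
  have h2 := card_filter_Ico_mul_of_periodic _ hper a (N / d + 1)
  rw [hcount] at h1 h2
  have hN1 : N / d * d ≤ N := Nat.div_mul_le_self N d
  have hN2 : N ≤ (N / d + 1) * d := (Nat.lt_mul_of_div_lt (Nat.lt_succ_self _) hd).le.trans
    (by rw [Nat.succ_eq_add_one, mul_comm])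
  have l1 : N / d * rootCount H d ≤ #{n ∈ Ico a (a + N) | d ∣ shiftProd H n} := by
    rw [← h1]
    exact card_le_card (filter_subset_filter _ (Ico_subset_Ico_right (by omega)))
  have l2 : #{n ∈ Ico a (a + N) | d ∣ shiftProd H n} ≤ (N / d + 1) * rootCount H d := by
    rw [← h2]
    exact card_le_card (filter_subset_filter _ (Ico_subset_Ico_right (by omega)))
  have hd0 : (0 : ℝ) < d := by exact_mod_cast hd
  have hr0 : (0 : ℝ) ≤ rootCount H d := Nat.cast_nonneg _
  have hrd : (rootCount H d : ℝ) ≤ d := by exact_mod_cast rootCount_le H d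
  have r1 : ((N / d : ℕ) : ℝ) * rootCount H d ≤ #{n ∈ Ico a (a + N) | d ∣ shiftProd H n} := by
    exact_mod_cast l1
  have r2 : (#{n ∈ Ico a (a + N) | d ∣ shiftProd H n} : ℝ) ≤
      (((N / d : ℕ) : ℝ) + 1) * rootCount H d := by exact_mod_cast l2
  have n1 : ((N / d : ℕ) : ℝ) ≤ N / d := Nat.cast_div_le
  have n2 : (N : ℝ) / d ≤ ((N / d : ℕ) : ℝ) + 1 := by
    rw [div_le_iff₀ hd0]; exact_mod_cast hN2
  have e : (rootCount H d : ℝ) / d * N = (N / d) * rootCount H d := by ring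
  rw [e, abs_le]
  constructor <;> nlinarith

/-- The density `d ↦ rootCount H d / d` as an arithmetic function. -/
noncomputable def rootDensity (H : Finset ℕ) : ArithmeticFunction ℝ :=
  ⟨fun d => rootCount H d / d, by simp⟩

theorem rootDensity_apply (H : Finset ℕ) (d : ℕ) :
    rootDensity H d = (rootCount H d : ℝ) / d := rfl

theorem isMultiplicative_rootDensity (H : Finset ℕ) : (rootDensity H).IsMultiplicative := by
  constructor
  · simp [rootDensity_apply, rootCount_one]
  · intro m n h
    rw [rootDensity_apply, rootDensity_apply, rootDensity_apply, rootCount_mul H h]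
    push_cast
    exact mul_div_mul_comm _ _ _ _

theorem rootDensity_prime (H : Finset ℕ) {p : ℕ} (hp : p.Prime) :
    rootDensity H p = (residueCount H p : ℝ) / p := by
  rw [rootDensity_apply, rootCount_prime H hp]

theorem residueCount_pos {H : Finset ℕ} (hH : H.Nonempty) (p : ℕ) : 0 < residueCount H p :=
  card_pos.2 (hH.image _)

theorem residueCount_le_card (H : Finset ℕ) (p : ℕ) : residueCount H p ≤ #H := card_image_le

theorem residueCount_le (H : Finset ℕ) {p : ℕ} (hp : p.Prime) : residueCount H p ≤ p :=
  rootCount_prime H hp ▸ rootCount_le H p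

/-- The sieve problem attached to `∏_{h ∈ H} (n + h)` for `n ∈ [a, a + N)` and primes up to `z`. -/
noncomputable def shiftSieve (H : Finset ℕ) (hH : H.Nonempty) (a N z : ℕ)
    (hadm : ∀ p ∈ z.primesLE, residueCount H p < p) : BoundingSieve where
  support := (Ico a (a + N)).image (shiftProd H)
  prodPrimes := primorial z
  prodPrimes_squarefree := squarefree_primorial z
  weights := fun _ => 1
  weights_nonneg := fun _ => zero_le_one
  totalMass := N
  nu := rootDensity H
  nu_mult := isMultiplicative_rootDensity H
  nu_pos_of_prime := fun p hp _ => by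
    rw [rootDensity_prime H hp]
    exact div_pos (by exact_mod_cast residueCount_pos hH p) (by exact_mod_cast hp.pos)
  nu_lt_one_of_prime := fun p hp hdvd => by
    rw [rootDensity_prime H hp, div_lt_one (by exact_mod_cast hp.pos)]
    exact_mod_cast hadm p (Nat.mem_primesLE.2 ⟨hp.dvd_primorial_iff.1 hdvd, hp⟩)

/-- The support of the sieve is a set of values without multiplicity; injectivity turns sums over it
into sums over `n`. -/
theorem shiftProd_injOn {H : Finset ℕ} (hH : H.Nonempty) {a : ℕ} (ha : 0 < a) (N : ℕ) :
    Set.InjOn (shiftProd H) (Ico a (a + N) : Finset ℕ) := by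
  have hlt : ∀ m n, 0 < m → m < n → shiftProd H m < shiftProd H n := fun m n hm hmn =>
    prod_lt_prod_of_nonempty (fun h _ => by omega) (fun h _ => by omega) hH
  intro m hm n hn hmn
  have hm' : a ≤ m := (mem_Ico.1 (mem_coe.1 hm)).1
  have hn' : a ≤ n := (mem_Ico.1 (mem_coe.1 hn)).1
  rcases lt_trichotomy m n with h | h | h
  · exact absurd hmn (hlt m n (by omega) h).ne
  · exact h
  · exact absurd hmn.symm (hlt n m (by omega) h).ne

/-- Selberg's bound for the number of `n ∈ [a, a + N)` with all `n + h` prime. -/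
theorem card_shift_primes_le {H : Finset ℕ} (hH : H.Nonempty) {a N z D : ℕ} (hz : 2 ≤ z)
    (hza : z < a) (hD : z ^ (6 * #H + 1) ≤ D)
    (hadm : ∀ p ∈ z.primesLE, residueCount H p < p) :
    (#{n ∈ Ico a (a + N) | ∀ h ∈ H, (n + h).Prime} : ℝ) ≤
      2 * (N + (D : ℝ) ^ 12) * ∏ p ∈ z.primesLE, (1 - (residueCount H p : ℝ) / p) := by
  set s := shiftSieve H hH a N z hadm with hs
  have hinj := shiftProd_injOn hH (by omega : 0 < a) N
  have hD1 : 1 ≤ D := (Nat.one_le_pow _ _ (by omega)).trans hD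
  have hP : s.prodPrimes = primorial z := rfl
  have hnup : ∀ p, p.Prime → s.nu p = (residueCount H p : ℝ) / p := fun p hp =>
    rootDensity_prime H hp
  have hsift : (#{n ∈ Ico a (a + N) | ∀ h ∈ H, (n + h).Prime} : ℝ) ≤ s.siftedSum := by
    have : s.siftedSum = ∑ n ∈ Ico a (a + N),
        if Nat.Coprime (primorial z) (shiftProd H n) then (1 : ℝ) else 0 := sum_image hinj
    rw [this, ← sum_filter, sum_const, nsmul_eq_mul, mul_one]
    refine Nat.cast_le.2 (card_le_card fun n hn => ?_)
    obtain ⟨h1, h2⟩ := mem_filter.1 hn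
    refine mem_filter.2 ⟨h1, ?_⟩
    -- Since `z < a ≤ n`, a prime `n + h` has no prime factor up to `z`.
    refine Nat.coprime_of_dvd fun p hp hpz hpn => ?_
    obtain ⟨h, hh, hd⟩ := (hp.prime.dvd_finsetProd_iff _).1 hpn
    have := (Nat.prime_dvd_prime_iff_eq hp (h2 h hh)).1 hd
    have hle := hp.dvd_primorial_iff.1 hpz
    have := (mem_Ico.1 h1).1
    omega
  have hnu1 : ∀ d, d ∣ s.prodPrimes → (1 : ℝ) ≤ d * s.nu d := by
    intro d hd
    have h0 := BoundingSieve.nu_pos_of_dvd_prodPrimes hd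
    have hd0 : (d : ℝ) ≠ 0 := by
      exact_mod_cast ne_zero_of_dvd_ne_zero s.prodPrimes_squarefree.ne_zero hd
    have h1 : (d : ℝ) * s.nu d = rootCount H d := mul_div_cancel₀ _ hd0
    have h2 : (0 : ℝ) < d * s.nu d := mul_pos (by positivity) h0
    rw [h1] at h2 ⊢
    exact_mod_cast h2
  have hrem : ∀ d, d ∣ s.prodPrimes → |s.rem d| ≤ d := by
    intro d hd
    have hd0 : 0 < d :=
      Nat.pos_of_ne_zero (ne_zero_of_dvd_ne_zero s.prodPrimes_squarefree.ne_zero hd)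
    have h1 : s.multSum d = #{n ∈ Ico a (a + N) | d ∣ shiftProd H n} := by
      have : s.multSum d = ∑ n ∈ Ico a (a + N), if d ∣ shiftProd H n then (1 : ℝ) else 0 :=
        sum_image hinj
      rw [this, ← sum_filter, sum_const, nsmul_eq_mul, mul_one]
    rw [BoundingSieve.rem, h1]
    exact abs_card_filter_dvd_sub_le H hd0 a N
  have hmain := siftedSum_le_div_selbergSum_add hD1 hnu1 hrem
  have hlow := half_prod_inv_le_selbergSum (k := #H) hz hP (fun p hp => by
    have hpp := Nat.prime_of_mem_primesLE hp
    rw [hnup p hpp]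
    have : (residueCount H p : ℝ) ≤ #H := by exact_mod_cast residueCount_le_card H p
    gcongr) hD
  have hup := selbergSum_le_sq (s := s) (D := D) (fun p hp hdvd => by
    have hp0 : (0 : ℝ) < p := by exact_mod_cast hp.pos
    have hlt := hadm p (Nat.mem_primesLE.2 ⟨hp.dvd_primorial_iff.1 hdvd, hp⟩)
    have hlt' : (residueCount H p : ℝ) + 1 ≤ p := by exact_mod_cast hlt
    rw [hnup p hp, le_sub_iff_add_le, ← add_div, div_le_one hp0]
    exact hlt')
  have hprod : ∏ p ∈ z.primesLE, (1 - s.nu p)⁻¹ =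
      (∏ p ∈ z.primesLE, (1 - (residueCount H p : ℝ) / p))⁻¹ := by
    rw [← prod_inv_distrib]
    exact prod_congr rfl fun p hp => by rw [hnup p (Nat.prime_of_mem_primesLE hp)]
  rw [hprod] at hlow
  have hV : 0 < ∏ p ∈ z.primesLE, (1 - (residueCount H p : ℝ) / p) := prod_pos fun p hp => by
    have hp0 : (0 : ℝ) < p := by exact_mod_cast (Nat.prime_of_mem_primesLE hp).pos
    rw [sub_pos, div_lt_one hp0]
    exact_mod_cast hadm p hp
  set V := ∏ p ∈ z.primesLE, (1 - (residueCount H p : ℝ) / p) with hVdef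
  have hG := one_le_selbergSum (s := s) hD1
  have hmass : s.totalMass = (N : ℝ) := rfl
  have hGV : 1 ≤ 2 * V * selbergSum s D := by
    have := mul_le_mul_of_nonneg_left hlow hV.le
    have e : V * (1 / 2 * V⁻¹) = 1 / 2 := by field_simp
    rw [e] at this
    linarith
  have h1 : s.totalMass / selbergSum s D ≤ 2 * N * V := by
    rw [hmass, div_le_iff₀ (by linarith)]
    nlinarith [(Nat.cast_nonneg N : (0 : ℝ) ≤ N)]
  -- `1 ≤ 2 V G` and `G ≤ D²` give `1 ≤ 2 V D²`, so the error becomes proportional to `V`.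
  have h2 : (D : ℝ) ^ 10 ≤ 2 * (D : ℝ) ^ 12 * V := by
    have h3 : 1 ≤ 2 * V * (D : ℝ) ^ 2 := hGV.trans (by gcongr)
    calc (D : ℝ) ^ 10 = (D : ℝ) ^ 10 * 1 := (mul_one _).symm
      _ ≤ (D : ℝ) ^ 10 * (2 * V * (D : ℝ) ^ 2) := by gcongr
      _ = _ := by ring
  calc _ ≤ _ := hsift
    _ ≤ _ := hmain
    _ ≤ 2 * N * V + 2 * (D : ℝ) ^ 12 * V := add_le_add h1 h2
    _ = _ := by ring

end PrimeGaps

/-! ### Bounds for the singular series -/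

namespace PrimeGaps

open Finset

theorem one_sub_one_div_prime_pos {p : ℕ} (hp : p.Prime) : 0 < 1 - 1 / (p : ℝ) := by
  have : (1 : ℝ) < p := by exact_mod_cast hp.one_lt
  rw [sub_pos, div_lt_one (by linarith)]
  exact this

theorem residueCount_div_le_one (H : Finset ℕ) {p : ℕ} (hp : p.Prime) :
    (residueCount H p : ℝ) / p ≤ 1 := by
  rw [div_le_one (by exact_mod_cast hp.pos)]
  exact_mod_cast residueCount_le H hp

theorem singularFactor_nonneg (H : Finset ℕ) {p : ℕ} (hp : p.Prime) : 0 ≤ singularFactor H p :=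
  mul_nonneg (sub_nonneg.2 (residueCount_div_le_one H hp))
    (inv_nonneg.2 (pow_nonneg (one_sub_one_div_prime_pos hp).le _))

theorem hasProd_singularSeries (H : Finset ℕ) :
    HasProd (fun p : Nat.Primes => singularFactor H p) (singularSeries H) :=
  (multipliable_singularFactor H).hasProd

theorem singularSeries_nonneg (H : Finset ℕ) : 0 ≤ singularSeries H :=
  ge_of_tendsto' (hasProd_singularSeries H) fun _ =>
    prod_nonneg fun p _ => singularFactor_nonneg H p.2

/-- Only `ν(p) ≤ #H` is used, so the bound holds also at primes where elements of `H` collide and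
depends on `H` through `#H` alone. -/
theorem one_sub_le_singularFactor (H : Finset ℕ) {p : ℕ} (hp : p.Prime) :
    1 - (2 : ℝ) ^ #H * (#H : ℝ) ^ 2 * (1 / (p : ℝ)) ^ 2 ≤ singularFactor H p := by
  have hp' : (2 : ℝ) ≤ p := by exact_mod_cast hp.two_le
  have hx2 : 1 / (p : ℝ) ≤ 1 / 2 := one_div_le_one_div_of_le (by norm_num) hp'
  have hx0 : 0 ≤ 1 / (p : ℝ) := by positivity
  have hν : (residueCount H p : ℝ) ≤ #H := by exact_mod_cast residueCount_le_card H p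
  have e1 : (residueCount H p : ℝ) / p = residueCount H p * (1 / (p : ℝ)) := by ring
  unfold singularFactor
  rw [e1]
  generalize 1 / (p : ℝ) = x at hx2 hx0
  generalize #H = k at hν
  have hpos : 0 < (1 - x) ^ k := pow_pos (by linarith) k
  have hup := one_sub_pow_le k x hx0 (by linarith)
  have hinv : ((1 - x) ^ k)⁻¹ ≤ 2 ^ k := by
    rw [← inv_pow]
    apply pow_le_pow_left₀ (inv_nonneg.2 (by linarith))
    rw [inv_le_comm₀ (by linarith) (by norm_num)]
    linarith
  have hnum : (1 - x) ^ k - (k : ℝ) ^ 2 * x ^ 2 ≤ 1 - residueCount H p * x := by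
    nlinarith
  calc 1 - (2 : ℝ) ^ k * (k : ℝ) ^ 2 * x ^ 2 = 1 - (k : ℝ) ^ 2 * x ^ 2 * 2 ^ k := by ring
    _ ≤ 1 - (k : ℝ) ^ 2 * x ^ 2 * ((1 - x) ^ k)⁻¹ := by gcongr
    _ = ((1 - x) ^ k - (k : ℝ) ^ 2 * x ^ 2) * ((1 - x) ^ k)⁻¹ := by
        rw [sub_mul, mul_inv_cancel₀ hpos.ne']
    _ ≤ _ := by gcongr

/-- Weierstrass's product inequality; when the left side for the smaller set is already nonpositive,
nonnegativity of the product suffices. -/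
theorem one_sub_sum_le_prod {ι : Type*} (T : Finset ι) (f a : ι → ℝ)
    (ha : ∀ i ∈ T, 0 ≤ a i) (hf0 : ∀ i ∈ T, 0 ≤ f i) (hf : ∀ i ∈ T, 1 - a i ≤ f i) :
    1 - ∑ i ∈ T, a i ≤ ∏ i ∈ T, f i := by
  classical
  induction T using Finset.induction_on with
  | empty => simp
  | insert i T hi ih =>
    have ih' := ih (fun j hj => ha j (mem_insert_of_mem hj))
      (fun j hj => hf0 j (mem_insert_of_mem hj)) fun j hj => hf j (mem_insert_of_mem hj)
    have h1 := ha i (mem_insert_self i T)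
    have h2 := hf0 i (mem_insert_self i T)
    have h3 := hf i (mem_insert_self i T)
    have h4 : 0 ≤ ∏ j ∈ T, f j := prod_nonneg fun j hj => hf0 j (mem_insert_of_mem hj)
    have h5 : 0 ≤ ∑ j ∈ T, a j := sum_nonneg fun j hj => ha j (mem_insert_of_mem hj)
    rw [sum_insert hi, prod_insert hi]
    rcases le_total (1 - ∑ j ∈ T, a j) 0 with h | h
    · have := mul_nonneg h2 h4
      linarith
    · calc 1 - (a i + ∑ j ∈ T, a j) ≤ (1 - a i) * (1 - ∑ j ∈ T, a j) := by nlinarith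
        _ ≤ f i * (1 - ∑ j ∈ T, a j) := by gcongr
        _ ≤ _ := by gcongr

/-- The partial products of the singular series exceed its value by at most a factor `2`. -/
theorem half_prod_singularFactor_le (H : Finset ℕ) {z : ℕ} (hz : 2 ^ (#H + 2) * #H ^ 2 ≤ z) :
    (1 / 2 : ℝ) * ∏ p ∈ z.primesLE, singularFactor H p ≤ singularSeries H := by
  set T₀ : Finset Nat.Primes := z.primesLE.subtype Nat.Prime with hT₀
  have hprod : ∏ p ∈ z.primesLE, singularFactor H p = ∏ p ∈ T₀, singularFactor H p := by
    rw [hT₀]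
    exact (prod_subtype_of_mem (singularFactor H) fun p hp => Nat.prime_of_mem_primesLE hp).symm
  rw [hprod]
  refine ge_of_tendsto (hasProd_singularSeries H) ?_
  filter_upwards [Filter.eventually_ge_atTop T₀] with T hT
  rw [← prod_sdiff hT]
  refine mul_le_mul_of_nonneg_right ?_ (prod_nonneg fun p _ => singularFactor_nonneg H p.2)
  set c : ℝ := (2 : ℝ) ^ #H * (#H : ℝ) ^ 2 with hc
  have hc0 : 0 ≤ c := by positivity
  have h1 := one_sub_sum_le_prod (T \ T₀) (fun p => singularFactor H p)
    (fun p => c * (1 / ((p : ℕ) : ℝ)) ^ 2) (fun p _ => by positivity)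
    (fun p _ => singularFactor_nonneg H p.2) fun p _ => one_sub_le_singularFactor H p.2
  refine le_trans ?_ h1
  have hbig : ∀ p ∈ T \ T₀, z < (p : ℕ) := by
    intro p hp
    by_contra hle
    refine (mem_sdiff.1 hp).2 ?_
    exact mem_subtype.2 (Nat.mem_primesLE.2 ⟨not_lt.1 hle, p.2⟩)
  have h2 : ∑ p ∈ T \ T₀, (1 / ((p : ℕ) : ℝ)) ^ 2 ≤ 2 / ((z : ℝ) + 1) := by
    set N := (T \ T₀).sup (fun p : Nat.Primes => (p : ℕ)) with hN
    have hmap : (T \ T₀).image (fun p : Nat.Primes => (p : ℕ)) ⊆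
        Ioo z (N + 1) := by
      intro n hn
      obtain ⟨p, hp, rfl⟩ := mem_image.1 hn
      exact mem_Ioo.2 ⟨hbig p hp, Nat.lt_succ_of_le
        (le_sup (f := fun p : Nat.Primes => (p : ℕ)) hp)⟩
    have h3 := sum_le_sum_of_subset_of_nonneg (f := fun n : ℕ => ((n : ℝ) ^ 2)⁻¹) hmap
      fun n _ _ => by positivity
    rw [sum_image (g := fun p : Nat.Primes => (p : ℕ))
      fun p _ q _ h => Nat.Primes.coe_nat_injective h] at h3
    refine le_trans (le_of_eq ?_) (h3.trans (sum_Ioo_inv_sq_le z (N + 1)))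
    exact sum_congr rfl fun p _ => by simp
  rw [← mul_sum]
  -- The hypothesis on `z` says exactly this; it makes the tail loss `2c / (z + 1)` at most 1/2.
  have hz' : 4 * c ≤ z := by
    have : ((2 ^ (#H + 2) * #H ^ 2 : ℕ) : ℝ) ≤ z := by exact_mod_cast hz
    push_cast at this
    rw [pow_add] at this
    rw [hc]; linarith
  have hz1 : (0 : ℝ) < z + 1 := by positivity
  have h4 : c * (2 / (z + 1)) ≤ 1 / 2 := by
    rw [← mul_div_assoc, div_le_iff₀ hz1]; linarith
  have h5 := mul_le_mul_of_nonneg_left h2 hc0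
  linarith

/-- The product of the positive differences of elements of `H`. -/
def differenceProduct (H : Finset ℕ) : ℕ := ∏ x ∈ (H ×ˢ H).filter (fun x => x.1 < x.2), (x.2 - x.1)

theorem differenceProduct_pos (H : Finset ℕ) : 0 < differenceProduct H :=
  prod_pos fun _ hx => Nat.sub_pos_of_lt (mem_filter.1 hx).2

theorem differenceProduct_le (H : Finset ℕ) {B : ℕ} (hB : 1 ≤ B) (hH : ∀ h ∈ H, h ≤ B) :
    differenceProduct H ≤ B ^ (#H ^ 2) := by
  calc differenceProduct H ≤ ∏ _x ∈ (H ×ˢ H).filter (fun x => x.1 < x.2), B :=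
        prod_le_prod' fun _ hx =>
          (Nat.sub_le _ _).trans (hH _ (mem_product.1 (mem_filter.1 hx).1).2)
    _ = B ^ #((H ×ˢ H).filter (fun x => x.1 < x.2)) := prod_const B
    _ ≤ _ := Nat.pow_le_pow_right hB ((card_filter_le _ _).trans (by rw [card_product, sq]))

theorem residueCount_eq_card_of_not_dvd {H : Finset ℕ} {p : ℕ}
    (hp : ¬ p ∣ differenceProduct H) : residueCount H p = #H := by
  have key : ∀ a ∈ H, ∀ b ∈ H, a % p = b % p → ¬ a < b := by
    intro a ha b hb hab hlt
    refine hp (dvd_trans ?_ (dvd_prod_of_mem (fun x : ℕ × ℕ => x.2 - x.1)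
      (mem_filter.2 ⟨mem_product.2 ⟨ha, hb⟩, hlt⟩ :
        (a, b) ∈ (H ×ˢ H).filter (fun x => x.1 < x.2))))
    exact (Nat.modEq_iff_dvd' hlt.le).1 hab
  refine card_image_of_injOn fun a ha b hb hab => ?_
  have h1 := key a ha b hb hab
  have h2 := key b hb a ha hab.symm
  omega

/-- Here `H` stays injective modulo `p`, so this is Bernoulli's inequality `1 - k/p ≤ (1 - 1/p) ^
k`. -/
theorem singularFactor_le_one {H : Finset ℕ} {p : ℕ} (hp : p.Prime)
    (hd : ¬ p ∣ differenceProduct H) : singularFactor H p ≤ 1 := by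
  have h0 := one_sub_one_div_prime_pos hp
  unfold singularFactor
  rw [residueCount_eq_card_of_not_dvd hd, ← div_eq_mul_inv, div_le_one (pow_pos h0 _)]
  have := one_add_mul_le_pow (a := -(1 / (p : ℝ))) (by linarith) #H
  calc 1 - (#H : ℝ) / p = 1 + #H * -(1 / (p : ℝ)) := by ring
    _ ≤ (1 + -(1 / (p : ℝ))) ^ #H := this
    _ = _ := by rw [← sub_eq_add_neg]

theorem singularFactor_le_pow (H : Finset ℕ) {p : ℕ} (hp : p.Prime) :
    singularFactor H p ≤ ((1 - 1 / (p : ℝ))⁻¹) ^ #H := by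
  have h0 := one_sub_one_div_prime_pos hp
  unfold singularFactor
  rw [inv_pow]
  refine mul_le_of_le_one_left (inv_nonneg.2 (pow_pos h0 _).le) ?_
  have : (0 : ℝ) ≤ (residueCount H p : ℝ) / p := by positivity
  linarith

theorem one_le_inv_one_sub_one_div_prime {p : ℕ} (hp : p.Prime) :
    1 ≤ (1 - 1 / (p : ℝ))⁻¹ := by
  have h0 := one_sub_one_div_prime_pos hp
  rw [one_le_inv₀ h0]
  have : 0 ≤ 1 / (p : ℝ) := by positivity
  linarith

theorem singularSeries_le_prod_primeFactors (H : Finset ℕ) :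
    singularSeries H ≤
      (∏ p ∈ (differenceProduct H).primeFactors, (1 - 1 / (p : ℝ))⁻¹) ^ #H := by
  refine le_of_tendsto' (hasProd_singularSeries H) fun T => ?_
  set Δ := differenceProduct H with hΔ
  have hΔ0 : Δ ≠ 0 := (differenceProduct_pos H).ne'
  rw [← prod_pow]
  set S := T.image (fun p : Nat.Primes => (p : ℕ)) with hS
  have hSp : ∀ p ∈ S, p.Prime := fun p hp => by
    obtain ⟨q, -, rfl⟩ := mem_image.1 hp
    exact q.2
  have hT : ∏ p ∈ T, singularFactor H p = ∏ p ∈ S, singularFactor H p :=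
    (prod_image (g := fun p : Nat.Primes => (p : ℕ))
      fun p _ q _ h => Nat.Primes.coe_nat_injective h).symm
  rw [hT]
  have hone : ∀ p ∈ S, singularFactor H p ≤
      if p ∣ Δ then ((1 - 1 / (p : ℝ))⁻¹) ^ #H else 1 := fun p hp => by
    split_ifs with h
    · exact singularFactor_le_pow H (hSp p hp)
    · exact singularFactor_le_one (hSp p hp) h
  refine (prod_le_prod (fun p hp => singularFactor_nonneg H (hSp p hp)) hone).trans ?_
  rw [← prod_filter]
  refine prod_le_prod_of_subset_of_one_le (fun p hp => ?_) (fun p hp => ?_) fun p hp _ => ?_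
  · obtain ⟨h1, h2⟩ := mem_filter.1 hp
    exact Nat.mem_primeFactors.2 ⟨hSp p h1, h2, hΔ0⟩
  · have := one_le_inv_one_sub_one_div_prime (hSp p (mem_filter.1 hp).1)
    positivity
  · exact one_le_pow₀ (one_le_inv_one_sub_one_div_prime (Nat.prime_of_mem_primeFactors hp))

theorem two_pow_card_primeFactors_le {n : ℕ} (hn : n ≠ 0) : 2 ^ #n.primeFactors ≤ n := by
  calc 2 ^ #n.primeFactors = ∏ _p ∈ n.primeFactors, 2 := (prod_const 2).symm
    _ ≤ ∏ p ∈ n.primeFactors, p :=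
        prod_le_prod' fun p hp => (Nat.prime_of_mem_primeFactors hp).two_le
    _ ≤ n := Nat.le_of_dvd (Nat.pos_of_ne_zero hn) (Nat.prod_primeFactors_dvd n)

/-- Such an `n` has at most `y` prime factors. Those up to `y` are covered by the Mertens product;
each larger one contributes at most `exp (2/y)`, together at most `exp 2`. -/
theorem exists_prod_primeFactors_inv_le :
    ∃ C : ℝ, 0 < C ∧ ∀ n y : ℕ, n ≠ 0 → 2 ≤ y → n ≤ 2 ^ y →
      ∏ p ∈ n.primeFactors, (1 - 1 / (p : ℝ))⁻¹ ≤ C * Real.log y ^ 16 := by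
  obtain ⟨C, hC, hM⟩ := exists_prod_inv_one_sub_inv_le
  refine ⟨C * Real.exp 2, by positivity, fun n y hn hy hny => ?_⟩
  have hy0 : (0 : ℝ) < y := by positivity
  rw [← prod_filter_mul_prod_filter_not n.primeFactors (· ≤ y)]
  have h1 : ∏ p ∈ n.primeFactors with p ≤ y, (1 - 1 / (p : ℝ))⁻¹ ≤ C * Real.log y ^ 16 := by
    refine le_trans ?_ (hM y hy)
    refine prod_le_prod_of_subset_of_one_le (fun p hp => ?_) (fun p hp => ?_) fun p hp _ => ?_
    · obtain ⟨h1, h2⟩ := mem_filter.1 hp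
      exact Nat.mem_primesLE.2 ⟨h2, Nat.prime_of_mem_primeFactors h1⟩
    · have := one_le_inv_one_sub_one_div_prime
        (Nat.prime_of_mem_primeFactors (mem_filter.1 hp).1)
      positivity
    · exact one_le_inv_one_sub_one_div_prime (Nat.prime_of_mem_primesLE hp)
  have h2 : ∏ p ∈ n.primeFactors with ¬ p ≤ y, (1 - 1 / (p : ℝ))⁻¹ ≤ Real.exp 2 := by
    have hterm : ∀ p ∈ n.primeFactors.filter (fun p => ¬ p ≤ y),
        (1 - 1 / (p : ℝ))⁻¹ ≤ Real.exp (2 / y) := by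
      intro p hp
      obtain ⟨h1, h2⟩ := mem_filter.1 hp
      have hpp := Nat.prime_of_mem_primeFactors h1
      have hp2 : (2 : ℝ) ≤ p := by exact_mod_cast hpp.two_le
      have hyp : (y : ℝ) ≤ p := by exact_mod_cast (not_le.1 h2).le
      have hx : 1 / (p : ℝ) ≤ 1 / 2 := one_div_le_one_div_of_le two_pos hp2
      have hxy : 1 / (p : ℝ) ≤ 1 / y := one_div_le_one_div_of_le hy0 hyp
      have hx0 : 0 ≤ 1 / (p : ℝ) := by positivity
      have e : (2 : ℝ) / y = 2 * (1 / y) := by ring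
      rw [e]
      generalize 1 / (p : ℝ) = x at hx hx0 hxy
      refine le_trans ?_ (Real.add_one_le_exp _)
      rw [inv_le_iff_one_le_mul₀ (by linarith)]
      nlinarith
    have hcard : #(n.primeFactors.filter (fun p => ¬ p ≤ y)) ≤ y := by
      refine (card_filter_le _ _).trans ?_
      exact (Nat.pow_le_pow_iff_right one_lt_two).1 ((two_pow_card_primeFactors_le hn).trans hny)
    calc _ ≤ ∏ p ∈ n.primeFactors with ¬ p ≤ y, Real.exp (2 / y) :=
          prod_le_prod (fun p hp => zero_le_one.trans (one_le_inv_one_sub_one_div_prime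
            (Nat.prime_of_mem_primeFactors (mem_filter.1 hp).1))) hterm
      _ = Real.exp (2 / y) ^ #(n.primeFactors.filter (fun p => ¬ p ≤ y)) := prod_const _
      _ ≤ Real.exp (2 / y) ^ y := pow_le_pow_right₀ (Real.one_le_exp (by positivity)) hcard
      _ = Real.exp 2 := by
          rw [← Real.exp_nat_mul]; congr 1; field_simp
  have hl : 0 ≤ Real.log y := Real.log_natCast_nonneg y
  calc _ ≤ (C * Real.log y ^ 16) * Real.exp 2 :=
        mul_le_mul h1 h2 (prod_nonneg fun p hp => zero_le_one.trans
          (one_le_inv_one_sub_one_div_prime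
            (Nat.prime_of_mem_primeFactors (mem_filter.1 hp).1))) (by positivity)
    _ = _ := by ring

/-- The singular series of a set of `O(X)`-bounded offsets is at most a power of `log log X`. -/
theorem exists_singularSeries_le (t : ℕ) (K : ℝ) :
    ∃ E : ℝ, 0 < E ∧ ∀ X : ℝ, 3 ≤ X → ∀ H : Finset ℕ, #H ≤ t + 1 → (∀ h ∈ H, (h : ℝ) ≤ K * X) →
      singularSeries H ≤ E * Real.log (Real.log (3 * X)) ^ (16 * (t + 1)) := by
  obtain ⟨C, hC, hM⟩ := exists_prod_primeFactors_inv_le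
  -- This absorbs `K`: offsets are at most `(3X) ^ (m + 1)`, hence the difference product is at most
  -- `(3X) ^ q`.
  obtain ⟨m, hm⟩ := pow_unbounded_of_one_lt (max K 1) (by norm_num : (1 : ℝ) < 3)
  set q : ℕ := (m + 1) * (t + 1) ^ 2 with hq
  have hq1 : (1 : ℝ) ≤ q := by exact_mod_cast Nat.one_le_iff_ne_zero.2 (by positivity)
  have hl2 : 0 < Real.log 2 := Real.log_pos one_lt_two
  set B : ℝ := Real.log (3 * q) + Real.log 2 with hB
  have hB0 : 0 < B := by
    have : 0 ≤ Real.log (3 * q) := Real.log_nonneg (by linarith)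
    linarith
  refine ⟨((C + 1) * (B / Real.log 2 + 1) ^ 16 * (1 / Real.log 2) ^ 16) ^ (t + 1),
    by positivity, ?_⟩
  intro X hX H hcard hbound
  set L := Real.log (3 * X) with hL
  have hL2 : 2 ≤ L := by
    have h9 : Real.log 9 ≤ L := Real.log_le_log (by norm_num) (by linarith)
    have : (2 : ℝ) ≤ Real.log 9 := by
      rw [Real.le_log_iff_exp_le (by norm_num), show (2 : ℝ) = 1 + 1 by norm_num, Real.exp_add]
      have := Real.exp_one_lt_d9
      have := Real.exp_pos 1
      nlinarith
    linarith
  have hLL : Real.log 2 ≤ Real.log L := Real.log_le_log two_pos hL2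
  set ℓ := Real.log L / Real.log 2 with hℓ
  have hℓ1 : 1 ≤ ℓ := (one_le_div hl2).2 hLL
  -- Since `log 2 ≥ 1/2`, this gives `(3X) ^ q ≤ 2 ^ y`, with `log y` of order `log log (3X)`.
  set y : ℕ := ⌈2 * q * L⌉₊ with hy
  have hyge : 2 * q * L ≤ y := Nat.le_ceil _
  have hyle : (y : ℝ) ≤ 3 * q * L := by
    have := (Nat.ceil_lt_add_one (by positivity : 0 ≤ 2 * q * L)).le
    have h1 : 1 ≤ q * L := by nlinarith
    linarith
  have hy2 : 2 ≤ y := by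
    have : (2 : ℝ) ≤ y := by nlinarith
    exact_mod_cast this
  have hΔ : differenceProduct H ≤ 2 ^ y := by
    set b : ℕ := ⌊(3 * X) ^ (m + 1)⌋₊ with hb
    have h3X : 1 ≤ 3 * X := by linarith
    have hb1 : 1 ≤ b := Nat.le_floor (by push_cast; exact one_le_pow₀ h3X)
    have hHb : ∀ h ∈ H, h ≤ b := fun h hh => by
      refine Nat.le_floor ((hbound h hh).trans ?_)
      calc K * X ≤ 3 ^ m * X := by
            have := (le_max_left K 1).trans hm.le
            gcongr
        _ ≤ (3 * X) ^ m * (3 * X) := by gcongr <;> linarith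
        _ = _ := (pow_succ _ _).symm
    have h1 := differenceProduct_le H hb1 hHb
    have h2 : (b : ℝ) ≤ (3 * X) ^ (m + 1) := Nat.floor_le (by positivity)
    have h3 : ((differenceProduct H : ℕ) : ℝ) ≤ 2 ^ y := by
      calc ((differenceProduct H : ℕ) : ℝ) ≤ (b : ℝ) ^ (#H ^ 2) := by exact_mod_cast h1
        _ ≤ ((3 * X) ^ (m + 1)) ^ (#H ^ 2) := by gcongr
        _ ≤ ((3 * X) ^ (m + 1)) ^ ((t + 1) ^ 2) :=
            pow_le_pow_right₀ (one_le_pow₀ h3X) (Nat.pow_le_pow_left hcard 2)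
        _ = Real.exp (q * L) := by
            rw [← pow_mul, hL, Real.exp_nat_mul, Real.exp_log (by linarith)]
        _ ≤ Real.exp (y * Real.log 2) := by
            apply Real.exp_le_exp.2
            have h5 : (1 : ℝ) / 2 ≤ Real.log 2 := by linarith [Real.log_two_gt_d9]
            calc (q : ℝ) * L = 2 * q * L * (1 / 2) := by ring
              _ ≤ y * Real.log 2 := mul_le_mul hyge h5 (by norm_num) (Nat.cast_nonneg y)
        _ = 2 ^ y := by rw [Real.exp_nat_mul, Real.exp_log two_pos]
    exact_mod_cast h3
  have hlogy : Real.log y ≤ (B / Real.log 2 + 1) * Real.log L := by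
    have h1 : Real.log y ≤ Real.log (3 * q) + Real.log L := by
      rw [← Real.log_mul (by positivity) (by positivity)]
      exact Real.log_le_log (by positivity) hyle
    have h2 : B ≤ B / Real.log 2 * Real.log L := by
      rw [div_mul_eq_mul_div, le_div_iff₀ hl2]
      gcongr
    have : Real.log (3 * q) ≤ B := by linarith
    linarith
  have hℓL : Real.log L = Real.log 2 * ℓ := by rw [hℓ]; field_simp
  have hlog0 : 0 ≤ Real.log y := Real.log_natCast_nonneg y
  have hP := hM _ y (differenceProduct_pos H).ne' hy2 hΔ
  have hP1 : 1 ≤ ∏ p ∈ (differenceProduct H).primeFactors, (1 - 1 / (p : ℝ))⁻¹ :=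
    prod_induction _ (fun x => 1 ≤ x) (fun a b ha hb => one_le_mul_of_one_le_of_one_le ha hb)
      le_rfl fun p hp => one_le_inv_one_sub_one_div_prime (Nat.prime_of_mem_primeFactors hp)
  have hpow : 0 ≤ (1 / Real.log 2) ^ 16 := by positivity
  have hl21 : 1 ≤ (1 / Real.log 2) ^ 16 :=
    one_le_pow₀ ((one_le_div hl2).2 (by linarith [Real.log_two_lt_d9]))
  calc singularSeries H
      ≤ (∏ p ∈ (differenceProduct H).primeFactors, (1 - 1 / (p : ℝ))⁻¹) ^ #H :=
        singularSeries_le_prod_primeFactors H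
    _ ≤ (∏ p ∈ (differenceProduct H).primeFactors, (1 - 1 / (p : ℝ))⁻¹) ^ (t + 1) :=
        pow_le_pow_right₀ hP1 hcard
    _ ≤ (C * Real.log y ^ 16) ^ (t + 1) := by gcongr
    _ ≤ ((C + 1) * ((B / Real.log 2 + 1) * Real.log L) ^ 16 * (1 / Real.log 2) ^ 16) ^ (t + 1) := by
        have hle : C * Real.log y ^ 16 ≤ (C + 1) * ((B / Real.log 2 + 1) * Real.log L) ^ 16 := by
          gcongr
          linarith
        have h0 : 0 ≤ C * Real.log y ^ 16 := by positivity
        exact pow_le_pow_left₀ h0 (hle.trans (le_mul_of_one_le_right (h0.trans hle) hl21)) _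
    _ = _ := by rw [pow_mul, ← mul_pow]; ring

end PrimeGaps

/-! ### Gap vectors, primes in `[X, 2X]`, and prime tuples -/

namespace PrimeGaps

open Finset

theorem nextPrime_prime (p : ℕ) : (nextPrime p).Prime :=
  (Nat.find_spec (Nat.exists_infinite_primes (p + 1))).2

theorem lt_nextPrime (p : ℕ) : p < nextPrime p :=
  (Nat.find_spec (Nat.exists_infinite_primes (p + 1))).1

/-- Bertrand's postulate; iterated, it bounds the offsets of any gap vector that occurs. -/
theorem nextPrime_le_two_mul {p : ℕ} (hp : p ≠ 0) : nextPrime p ≤ 2 * p := by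
  obtain ⟨q, hq, hpq, hq2⟩ := Nat.exists_prime_lt_and_le_two_mul p hp
  exact (Nat.find_min' _ ⟨hpq, hq⟩).trans hq2

theorem iterate_nextPrime_prime {p : ℕ} (hp : p.Prime) (j : ℕ) : (nextPrime^[j] p).Prime := by
  cases j with
  | zero => exact hp
  | succ j => rw [Function.iterate_succ_apply']; exact nextPrime_prime _

theorem iterate_nextPrime_le {p : ℕ} (hp : p.Prime) (j : ℕ) : nextPrime^[j] p ≤ 2 ^ j * p := by
  induction j with
  | zero => simp
  | succ j ih =>
    rw [Function.iterate_succ_apply', pow_succ', mul_assoc]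
    exact (nextPrime_le_two_mul (iterate_nextPrime_prime hp j).ne_zero).trans
      (Nat.mul_le_mul_left 2 ih)

theorem offset_zero {t : ℕ} (g : Fin t → ℕ) : offset g 0 = 0 := by
  simp [offset]

theorem offset_succ {t : ℕ} (g : Fin t → ℕ) (i : Fin t) :
    offset g i.succ = offset g i.castSucc + g i := by
  have : (univ.filter fun j : Fin t => j.val < i.succ.val) =
      insert i (univ.filter fun j : Fin t => j.val < i.castSucc.val) := by
    ext j
    simp only [mem_filter, mem_univ, true_and, mem_insert, Fin.ext_iff, Fin.val_succ,
      Fin.val_castSucc]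
    omega
  rw [offset, this, sum_insert (by simp), offset, add_comm]

theorem iterate_nextPrime_eq_add_offset {t p : ℕ} {g : Fin t → ℕ} (hg : gapVector t p = g)
    (k : Fin (t + 1)) : nextPrime^[k.val] p = p + offset g k := by
  induction k using Fin.induction with
  | zero => simp [offset_zero]
  | succ i ih =>
    rw [Fin.val_castSucc] at ih
    rw [offset_succ, ← add_assoc, ← ih, Fin.val_succ, Function.iterate_succ_apply', ← hg]
    exact (Nat.add_sub_cancel' (lt_nextPrime _).le).symm

theorem pos_of_gapVector_eq {t p : ℕ} {g : Fin t → ℕ} (hg : gapVector t p = g) (i : Fin t) :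
    0 < g i := by
  rw [← hg]
  exact Nat.sub_pos_of_lt (lt_nextPrime _)

theorem card_offsetSet_le {t : ℕ} (g : Fin t → ℕ) : #(offsetSet g) ≤ t + 1 :=
  card_image_le.trans (by simp)

theorem card_offsetSet {t : ℕ} {g : Fin t → ℕ} (hg : ∀ i, 0 < g i) :
    #(offsetSet g) = t + 1 := by
  have hmono : StrictMono (offset g) := Fin.strictMono_iff_lt_succ.2 fun i => by
    rw [offset_succ]; exact Nat.lt_add_of_pos_right (hg i)
  rw [offsetSet, card_image_of_injective _ hmono.injective]
  simp

theorem le_offset_last_of_mem {t : ℕ} {g : Fin t → ℕ} {h : ℕ} (hh : h ∈ offsetSet g) :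
    h ≤ offset g (Fin.last t) := by
  obtain ⟨k, -, rfl⟩ := mem_image.1 hh
  refine sum_le_sum_of_subset fun i hi => mem_filter.2 ⟨mem_univ i, ?_⟩
  exact i.isLt

theorem prime_add_of_gapVector_eq {t p : ℕ} (hp : p.Prime) {g : Fin t → ℕ}
    (hg : gapVector t p = g) {h : ℕ} (hh : h ∈ offsetSet g) : (p + h).Prime := by
  obtain ⟨k, -, rfl⟩ := mem_image.1 hh
  rw [← iterate_nextPrime_eq_add_offset hg]
  exact iterate_nextPrime_prime hp _

/-- `dyadicPrimes X` as a finset. -/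
noncomputable def dyadicPrimesFinset (X : ℝ) : Finset ℕ :=
  (Ico ⌈X⌉₊ (⌊2 * X⌋₊ + 1)).filter Nat.Prime

theorem coe_dyadicPrimesFinset {X : ℝ} (hX : 0 ≤ X) :
    (dyadicPrimesFinset X : Set ℕ) = dyadicPrimes X := by
  ext p
  simp only [dyadicPrimesFinset, coe_filter, mem_Ico, Set.mem_ofPred_eq, dyadicPrimes,
    Nat.ceil_le, Nat.lt_succ_iff, Nat.le_floor_iff (by positivity : 0 ≤ 2 * X)]
  tauto

theorem gapLaw_real_singleton (t : ℕ) {X : ℝ} (hX : 0 ≤ X) (g : Fin t → ℕ) :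
    (gapLaw t X).real {g} =
      #{p ∈ dyadicPrimesFinset X | gapVector t p = g} / #(dyadicPrimesFinset X) := by
  rw [MeasureTheory.measureReal_def, gapLaw,
    MeasureTheory.Measure.map_apply Measurable.of_discrete (measurableSet_singleton g),
    ← coe_dyadicPrimesFinset hX, ← ProbabilityTheory.uniformOn_inter_self (finite_toSet _)]
  have : (dyadicPrimesFinset X : Set ℕ) ∩ gapVector t ⁻¹' {g} =
      (({p ∈ dyadicPrimesFinset X | gapVector t p = g} : Finset ℕ) : Set ℕ) := by
    ext p; simp
  rw [this, ProbabilityTheory.uniformOn_apply_finset, inter_eq_right.2 (filter_subset _ _),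
    ENNReal.toReal_div, ENNReal.toReal_natCast, ENNReal.toReal_natCast]

/-- For `n = ⌊X⌋` the primes in `(n, 2n]` lie in `[X, 2X]`. The 24 is `6 · 2 · 2`, from `n ≥ X/2`
and `log (2n) ≤ 2 log X`. -/
theorem exists_le_card_dyadicPrimesFinset :
    ∃ X₀ : ℝ, ∀ X : ℝ, X₀ ≤ X → X / (24 * Real.log X) ≤ #(dyadicPrimesFinset X) := by
  obtain ⟨N₀, hN₀⟩ := exists_le_card_upperHalfPrimes
  refine ⟨max 2 N₀, fun X hX => ?_⟩
  have hX2 : 2 ≤ X := (le_max_left _ _).trans hX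
  set n := ⌊X⌋₊ with hn
  have hnX : (n : ℝ) ≤ X := Nat.floor_le (by linarith)
  have hXn : X < n + 1 := Nat.lt_floor_add_one X
  have h := hN₀ n (Nat.le_floor ((le_max_right _ _).trans hX))
  have hsub : upperHalfPrimes n ⊆ dyadicPrimesFinset X := by
    intro p hp
    obtain ⟨h1, h2⟩ := mem_filter.1 hp
    obtain ⟨h3, h4⟩ := Nat.mem_primesLE.1 h1
    refine mem_filter.2 ⟨mem_Ico.2 ⟨Nat.ceil_le.2 ?_, Nat.lt_succ_of_le (Nat.le_floor ?_)⟩, h4⟩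
    · have : (n : ℝ) + 1 ≤ p := by exact_mod_cast h2
      linarith
    · have : (p : ℝ) ≤ 2 * n := by exact_mod_cast h3
      linarith
  have hcard : (#(upperHalfPrimes n) : ℝ) ≤ #(dyadicPrimesFinset X) := by
    exact_mod_cast card_le_card hsub
  refine le_trans ?_ (h.trans hcard)
  have hn1 : (1 : ℝ) ≤ n := by
    exact_mod_cast Nat.le_floor (by push_cast; linarith : ((1 : ℕ) : ℝ) ≤ X)
  have hlX : 0 < Real.log X := Real.log_pos (by linarith)
  have hl : Real.log (2 * n) ≤ 2 * Real.log X := by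
    have h1 : Real.log (2 * n) ≤ Real.log (X * X) :=
      Real.log_le_log (by linarith) (mul_le_mul hX2 hnX (by linarith) (by linarith))
    have h2 : Real.log (X * X) = Real.log X + Real.log X :=
      Real.log_mul (by linarith) (by linarith)
    linarith
  have hl0 : 0 < Real.log (2 * n) := Real.log_pos (by linarith)
  calc X / (24 * Real.log X) = (1 / 6 * (X / 2)) / (2 * Real.log X) := by field_simp; norm_num
    _ ≤ (1 / 6 * n) / Real.log (2 * n) := by gcongr; linarith

/-- No `n ≥ a` has all `n + h` prime if `H` covers all residue classes modulo a prime below `a`. -/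
theorem filter_shift_primes_eq_empty {H : Finset ℕ} {a N p : ℕ} (hp : p.Prime) (hpa : p < a)
    (hH : p ≤ residueCount H p) : {n ∈ Ico a (a + N) | ∀ h ∈ H, (n + h).Prime} = ∅ := by
  rw [filter_eq_empty_iff]
  intro n hn hprime
  have hfull : {r ∈ range p | p ∣ shiftProd H r} = range p := by
    refine eq_of_subset_of_card_le (filter_subset _ _) ?_
    rw [card_range]
    exact hH.trans (rootCount_prime H hp).ge
  have hmem : n % p ∈ {r ∈ range p | p ∣ shiftProd H r} := by
    rw [hfull]; exact mem_range.2 (Nat.mod_lt n hp.pos)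
  have hdvd := (dvd_shiftProd_iff H (Nat.mod_modEq n p)).1 (mem_filter.1 hmem).2
  obtain ⟨h, hh, hd⟩ := (hp.prime.dvd_finsetProd_iff _).1 hdvd
  have := (Nat.prime_dvd_prime_iff_eq hp (hprime h hh)).1 hd
  have := (mem_Ico.1 hn).1
  omega

theorem prod_one_sub_residueCount_div_eq (H : Finset ℕ) (z : ℕ) :
    ∏ p ∈ z.primesLE, (1 - (residueCount H p : ℝ) / p) =
      (∏ p ∈ z.primesLE, singularFactor H p) * (∏ p ∈ z.primesLE, (1 - 1 / (p : ℝ))) ^ #H := by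
  rw [← prod_pow, ← prod_mul_distrib]
  refine prod_congr rfl fun p hp => ?_
  have := pow_pos (one_sub_one_div_prime_pos (Nat.prime_of_mem_primesLE hp)) #H
  rw [singularFactor, mul_assoc, inv_mul_cancel₀ this.ne', mul_one]

/-- The upper bound of the correct order for prime tuples, uniform in the shifts. -/
theorem exists_card_prime_tuples_le (k : ℕ) (hk : 1 ≤ k) :
    ∃ C X₀ : ℝ, 0 < C ∧ 3 ≤ X₀ ∧ ∀ X : ℝ, X₀ ≤ X → ∀ H : Finset ℕ, #H = k →
      (#{n ∈ Ico ⌈X⌉₊ (⌊2 * X⌋₊ + 1) | ∀ h ∈ H, (n + h).Prime} : ℝ) ≤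
        C * X * singularSeries H / Real.log X ^ k := by
  set s : ℕ := 6 * k + 1 with hs
  set W : ℕ := 2 ^ (k + 2) * k ^ 2 with hW
  have hW4 : 4 ≤ W := by
    have h1 : 2 ^ 2 ≤ 2 ^ (k + 2) := Nat.pow_le_pow_right two_pos (by omega)
    have h2 : 1 ≤ k ^ 2 := Nat.one_le_pow _ _ hk
    calc 4 = 2 ^ 2 * 1 := by norm_num
      _ ≤ _ := Nat.mul_le_mul h1 h2
  have hW4' : (4 : ℝ) ≤ W := by exact_mod_cast hW4
  have hs0 : 24 * s ≠ 0 := by omega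
  refine ⟨12 * (24 * s) ^ k, (W : ℝ) ^ (24 * s), by positivity, ?_, fun X hX H hH => ?_⟩
  · calc (3 : ℝ) ≤ W := by linarith
      _ ≤ (W : ℝ) ^ (24 * s) := le_self_pow₀ (by linarith) hs0
  have hX4 : 4 ≤ X := hW4'.trans ((le_self_pow₀ (by linarith) hs0).trans hX)
  -- With `z = ⌊u²⌋` and level `D = z ^ s`, the error `D ^ 12 = z ^ (12 s)` is at most `X`. Taking
  -- `u²` leaves room for the floor: still `z ≥ u`, so `log X ≤ 24 s log z`.
  set u : ℝ := X ^ (((24 * s : ℕ) : ℝ)⁻¹) with hu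
  have hu0 : 0 ≤ u := Real.rpow_nonneg (by linarith) _
  have huX : u ^ (24 * s) = X := Real.rpow_inv_natCast_pow (by linarith) hs0
  have huW : (W : ℝ) ≤ u := (pow_le_pow_iff_left₀ (by linarith) hu0 hs0).1 (huX.symm ▸ hX)
  set z : ℕ := ⌊u ^ 2⌋₊ with hz
  have hzu2 : (z : ℝ) ≤ u ^ 2 := Nat.floor_le (by positivity)
  have huz : u ≤ z := by
    have := Nat.lt_floor_add_one (u ^ 2)
    nlinarith
  have hWz : W ≤ z := by exact_mod_cast huW.trans huz
  have hz4 : (4 : ℝ) ≤ z := by linarith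
  have hzX : (z : ℝ) ^ (12 * s) ≤ X := by
    calc (z : ℝ) ^ (12 * s) ≤ (u ^ 2) ^ (12 * s) := by gcongr
      _ = X := by rw [← pow_mul, ← huX]; congr 1; ring
  have hza : z < ⌈X⌉₊ := by
    rw [Nat.lt_ceil]
    refine lt_of_lt_of_le ?_ hzX
    exact lt_self_pow₀ (by linarith) (by omega)
  have hle : ⌈X⌉₊ ≤ ⌊2 * X⌋₊ + 1 := by
    refine Nat.ceil_le.2 ?_
    have := (Nat.lt_floor_add_one (2 * X)).le
    push_cast; linarith
  obtain ⟨N, hN⟩ := Nat.exists_eq_add_of_le hle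
  rw [hN]
  have hlX : 0 < Real.log X := Real.log_pos (by linarith)
  have hS := singularSeries_nonneg H
  -- If `H` covers all classes modulo some `p ≤ z`, nothing is counted; otherwise the sieve
  -- densities are below 1.
  by_cases hadm : ∀ p ∈ z.primesLE, residueCount H p < p
  swap
  · push Not at hadm
    obtain ⟨p, hp, hle⟩ := hadm
    obtain ⟨hpz, hpp⟩ := Nat.mem_primesLE.1 hp
    rw [filter_shift_primes_eq_empty hpp (by omega) hle, card_empty, Nat.cast_zero]
    have : (0 : ℝ) ≤ X := by linarith
    positivity
  have hNX : (N : ℝ) ≤ 2 * X := by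
    have h1 : ((⌊2 * X⌋₊ : ℕ) : ℝ) ≤ 2 * X := Nat.floor_le (by linarith)
    have h2 := Nat.le_ceil X
    have h3 : ((⌊2 * X⌋₊ : ℕ) : ℝ) + 1 = (⌈X⌉₊ : ℝ) + N := by exact_mod_cast hN
    linarith
  have hmain := card_shift_primes_le (card_pos.1 (by omega : 0 < #H)) (N := N)
    (by omega : 2 ≤ z) hza (le_of_eq (by rw [hH]) : z ^ (6 * #H + 1) ≤ z ^ s) hadm
  have hD : (((z ^ s : ℕ) : ℝ)) ^ 12 ≤ X := by
    push_cast
    rw [← pow_mul, mul_comm]; exact hzX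
  have hlz : 0 < Real.log z := Real.log_pos (by linarith)
  have hlXz : Real.log X ≤ 24 * s * Real.log z := by
    rw [← huX, Real.log_pow]
    push_cast
    gcongr
  have hf0 : 0 ≤ ∏ p ∈ z.primesLE, singularFactor H p :=
    prod_nonneg fun p hp => singularFactor_nonneg H (Nat.prime_of_mem_primesLE hp)
  have hm0 : 0 ≤ ∏ p ∈ z.primesLE, (1 - 1 / (p : ℝ)) :=
    prod_nonneg fun p hp => (one_sub_one_div_prime_pos (Nat.prime_of_mem_primesLE hp)).le
  have hV : ∏ p ∈ z.primesLE, (1 - (residueCount H p : ℝ) / p) ≤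
      2 * singularSeries H * ((24 * s : ℝ) / Real.log X) ^ k := by
    rw [prod_one_sub_residueCount_div_eq, hH]
    have h1 : ∏ p ∈ z.primesLE, singularFactor H p ≤ 2 * singularSeries H := by
      have := half_prod_singularFactor_le H (z := z) (by rw [hH]; exact hWz)
      linarith
    have h2 : ∏ p ∈ z.primesLE, (1 - 1 / (p : ℝ)) ≤ (24 * s : ℝ) / Real.log X := by
      refine (prod_one_sub_inv_primesLE_le (by omega)).trans ?_
      rw [inv_eq_one_div, div_le_div_iff₀ hlz hlX]
      linarith
    gcongr
  have hV0 : 0 ≤ ∏ p ∈ z.primesLE, (1 - (residueCount H p : ℝ) / p) := by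
    rw [prod_one_sub_residueCount_div_eq]
    exact mul_nonneg hf0 (pow_nonneg hm0 _)
  calc _ ≤ _ := hmain
    _ ≤ 2 * (2 * X + X) * (2 * singularSeries H * ((24 * s : ℝ) / Real.log X) ^ k) := by gcongr
    _ = _ := by rw [div_pow]; ring

end PrimeGaps

/-! ### Assembly of the three bounds -/

theorem mainTheorem6 (t : ℕ) (ht : 1 ≤ t) :
    ∃ (C X₀ : ℝ) (A : ℕ), 0 < C ∧
      (∀ X : ℝ, X₀ ≤ X → ∀ g : Fin t → ℕ,
        (PrimeGaps.gapLaw t X).real {g} ≤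
          C * PrimeGaps.singularSeries (PrimeGaps.offsetSet g) / Real.log X ^ t) ∧
      (∀ K : ℝ, 0 < K → ∃ D : ℝ, 0 < D ∧ ∀ X : ℝ, X₀ ≤ X → ∀ g : Fin t → ℕ,
        (PrimeGaps.offset g (Fin.last t) : ℝ) ≤ K * X →
          C * PrimeGaps.singularSeries (PrimeGaps.offsetSet g) / Real.log X ^ t ≤
            D * Real.log (Real.log (3 * X)) ^ A / Real.log X ^ t) ∧
      (∃ D : ℝ, 0 < D ∧ ∀ X : ℝ, X₀ ≤ X → ∀ g : Fin t → ℕ,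
        (PrimeGaps.gapLaw t X).real {g} ≤
          D * Real.log (Real.log (3 * X)) ^ A / Real.log X ^ t) := by
  obtain ⟨C, X₁, hC, hX₁, hcount⟩ := PrimeGaps.exists_card_prime_tuples_le (t + 1) (by omega)
  obtain ⟨X₂, hprimes⟩ := PrimeGaps.exists_le_card_dyadicPrimesFinset
  have hzero : ∀ X : ℝ, 3 ≤ X → ∀ g : Fin t → ℕ,
      (∀ p ∈ PrimeGaps.dyadicPrimesFinset X, PrimeGaps.gapVector t p ≠ g) →
        (PrimeGaps.gapLaw t X).real {g} = 0 := fun X hX g h => by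
    rw [PrimeGaps.gapLaw_real_singleton t (by linarith), Finset.filter_eq_empty_iff.2 (h ·)]
    simp
  have hi : ∀ X : ℝ, max X₁ X₂ ≤ X → ∀ g : Fin t → ℕ,
      (PrimeGaps.gapLaw t X).real {g} ≤
        (24 * C) * PrimeGaps.singularSeries (PrimeGaps.offsetSet g) / Real.log X ^ t := by
    intro X hX g
    have hX3 : 3 ≤ X := hX₁.trans ((le_max_left _ _).trans hX)
    have hlX : 0 < Real.log X := Real.log_pos (by linarith)
    have hS := PrimeGaps.singularSeries_nonneg (PrimeGaps.offsetSet g)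
    -- Vectors that do not occur have mass 0. One that occurs has positive entries, so its offsets
    -- are distinct and the tuple bound applies with exactly `t + 1` shifts.
    by_cases hex : ∀ p ∈ PrimeGaps.dyadicPrimesFinset X, PrimeGaps.gapVector t p ≠ g
    · rw [hzero X hX3 g hex]; positivity
    push Not at hex
    obtain ⟨p, -, hpg⟩ := hex
    have hcard := PrimeGaps.card_offsetSet (PrimeGaps.pos_of_gapVector_eq hpg)
    have h1 := hcount X ((le_max_left _ _).trans hX) _ hcard
    have h2 := hprimes X ((le_max_right _ _).trans hX)
    have h3 : ({p ∈ PrimeGaps.dyadicPrimesFinset X | PrimeGaps.gapVector t p = g}.card : ℝ) ≤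
        ({n ∈ Finset.Ico ⌈X⌉₊ (⌊2 * X⌋₊ + 1) |
          ∀ h ∈ PrimeGaps.offsetSet g, (n + h).Prime}.card : ℝ) := by
      refine Nat.cast_le.2 (Finset.card_le_card fun q hq => ?_)
      obtain ⟨hq1, hq2⟩ := Finset.mem_filter.1 hq
      obtain ⟨hq3, hq4⟩ := Finset.mem_filter.1 hq1
      exact Finset.mem_filter.2
        ⟨hq3, fun h hh => PrimeGaps.prime_add_of_gapVector_eq hq4 hq2 hh⟩
    have hX0 : 0 < X / (24 * Real.log X) := div_pos (by linarith) (by positivity)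
    rw [PrimeGaps.gapLaw_real_singleton t (by linarith), div_le_iff₀ (hX0.trans_le h2)]
    refine (h3.trans h1).trans ?_
    calc C * X * PrimeGaps.singularSeries (PrimeGaps.offsetSet g) / Real.log X ^ (t + 1)
        = (24 * C) * PrimeGaps.singularSeries (PrimeGaps.offsetSet g) / Real.log X ^ t *
            (X / (24 * Real.log X)) := by
          rw [pow_succ]
          field_simp
      _ ≤ _ := mul_le_mul_of_nonneg_left h2 (by positivity)
  have hii : ∀ K : ℝ, 0 < K → ∃ D : ℝ, 0 < D ∧ ∀ X : ℝ, max X₁ X₂ ≤ X → ∀ g : Fin t → ℕ,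
      (PrimeGaps.offset g (Fin.last t) : ℝ) ≤ K * X →
        (24 * C) * PrimeGaps.singularSeries (PrimeGaps.offsetSet g) / Real.log X ^ t ≤
          D * Real.log (Real.log (3 * X)) ^ (16 * (t + 1)) / Real.log X ^ t := by
    intro K _
    obtain ⟨E, hE, hbound⟩ := PrimeGaps.exists_singularSeries_le t K
    refine ⟨24 * C * E, by positivity, fun X hX g hg => ?_⟩
    have hX3 : 3 ≤ X := hX₁.trans ((le_max_left _ _).trans hX)
    have hlX : 0 < Real.log X := Real.log_pos (by linarith)
    have h := hbound X hX3 _ (PrimeGaps.card_offsetSet_le g) fun h hh =>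
      (Nat.cast_le.2 (PrimeGaps.le_offset_last_of_mem hh)).trans hg
    rw [mul_assoc (24 * C)]
    gcongr
  refine ⟨24 * C, max X₁ X₂, 16 * (t + 1), by positivity, hi, hii, ?_⟩
  obtain ⟨D, hD, hbound⟩ := hii (2 ^ (t + 1)) (by positivity)
  refine ⟨D, hD, fun X hX g => ?_⟩
  have hX3 : 3 ≤ X := hX₁.trans ((le_max_left _ _).trans hX)
  by_cases hex : ∀ p ∈ PrimeGaps.dyadicPrimesFinset X, PrimeGaps.gapVector t p ≠ g
  · rw [hzero X hX3 g hex]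
    have hlX : 0 < Real.log X := Real.log_pos (by linarith)
    -- The exponent is even, so the sign of the iterated logarithm is irrelevant.
    have : 0 ≤ Real.log (Real.log (3 * X)) ^ (16 * (t + 1)) :=
      (Even.mul_right (by decide) _).pow_nonneg _
    positivity
  push Not at hex
  obtain ⟨p, hp, hpg⟩ := hex
  refine (hi X hX g).trans (hbound X hX g ?_)
  obtain ⟨hp1, hpp⟩ := Finset.mem_filter.1 hp
  have hp2X : (p : ℝ) ≤ 2 * X :=
    (Nat.le_floor_iff (by linarith)).1 (Nat.lt_succ_iff.1 (Finset.mem_Ico.1 hp1).2)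
  have h1 : PrimeGaps.offset g (Fin.last t) ≤ 2 ^ t * p := by
    have h2 := PrimeGaps.iterate_nextPrime_eq_add_offset hpg (Fin.last t)
    have h3 := PrimeGaps.iterate_nextPrime_le hpp t
    rw [Fin.val_last] at h2
    omega
  calc (PrimeGaps.offset g (Fin.last t) : ℝ) ≤ 2 ^ t * p := by exact_mod_cast h1
    _ ≤ 2 ^ t * (2 * X) := by gcongr
    _ = _ := by ring
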